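/- Let $\mathbf{k}$ be an arbitrary field, let $S=\mathbf{k}[x,y,z]$, and let $I\subseteq S$ be a monomial ideal such that $S/I$ is finite-dimensional over $\mathbf{k}$, with $d=\dim_{\mathbf{k}}(S/I)$. Let $T(I)=\mathrm{Hom}_S(I,S/I)$. For $\alpha\in\mathbf{Z}^3$ let $|T(I)|_\alpha\subseteq T(I)$ be the graded component of degree $\alpha$, that is, the space of $S$-linear maps $I\to S/I$ that send homogeneous elements of $I$ of degree $\beta$ to elements of $S/I$ of degree $\alpha+\beta$, for every $\beta\in\mathbf{Z}^3$. For a triple $\mathfrak{s}=\mathfrak{s}_1\mathfrak{s}_2\mathfrak{s}_3$ of letters $\mathrm{p}$ ("positive or $0$") and $\mathrm{n}$ ("negative"), let $\mathbf{Z}^3_{\mathfrak{s}}$ be the set of $\alpha\in\mathbf{Z}^3$ with $\alpha_i\ge 0$ whenever $\mathfrak{s}_i=\mathrm{p}$ and $\alpha_i<0$ whenever $\mathfrak{s}_i=\mathrm{n}$, and put $$T_{\mathfrak{s}}(I)=\bigoplus_{\alpha\in\mathbf{Z}^3_{\mathfrak{s}}}|T(I)|_\alpha\subseteq T(I).$$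 Then $T(I)$ is finite-dimensional over $\mathbf{k}$, and $$\dim_{\mathbf{k}} T_{\mathrm{ppn}}(I)=\dim_{\mathbf{k}} T_{\mathrm{nnp}}(I)+d,\quad \dim_{\mathbf{k}} T_{\mathrm{pnp}}(I)=\dim_{\mathbf{k}} T_{\mathrm{npn}}(I)+d,\quad \dim_{\mathbf{k}} T_{\mathrm{npp}}(I)=\dim_{\mathbf{k}} T_{\mathrm{pnn}}(I)+d.$$ As a consequence, $\dim_{\mathbf{k}} T(I)\equiv d \pmod 2$. -/

import Mathlib

open MvPolynomial

/-- The two letters of a signature: `p` is "positive or zero", `n` is "negative". -/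
inductive SignLetter : Type
  | p : SignLetter
  | n : SignLetter

/-- The condition that a letter puts on a coordinate: `0 ≤ a` for `p` and `a < 0` for `n`. -/
def SignLetter.Admits : SignLetter → ℤ → Prop
  | SignLetter.p, a => 0 ≤ a
  | SignLetter.n, a => a < 0

/-- The set of all degrees in `ℤⁿ` whose coordinates have the signs prescribed by `s`. -/
def signatureDegrees {n : ℕ} (s : Fin n → SignLetter) : Set (Fin n → ℤ) :=
  {α | ∀ i, (s i).Admits (α i)}

/-- An ideal of a polynomial ring is a monomial ideal if it is generated by monomials. -/
def IsMonomialIdeal {k : Type*} [Field k] {n : ℕ} (I : Ideal (MvPolynomial (Fin n) k)) : Prop :=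
  ∃ A : Set (Fin n →₀ ℕ), I = Ideal.span ((fun u => monomial u (1 : k)) '' A)

/-- The graded component of degree `γ ∈ ℤⁿ` of `S = k[x₁, …, xₙ]`: it is spanned by the monomial
with exponent vector `γ` if `γ` has nonnegative coordinates, and is zero otherwise. -/
noncomputable def polyPiece (k : Type*) [Field k] {n : ℕ} (γ : Fin n → ℤ) :
    Submodule k (MvPolynomial (Fin n) k) :=
  Submodule.span k {f | ∃ u : Fin n →₀ ℕ, (∀ i, (u i : ℤ) = γ i) ∧ f = monomial u (1 : k)}

/-- The graded component of degree `γ ∈ ℤⁿ` of `S ⧸ I`: the image of that of `S`. -/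
noncomputable def quotientPiece {k : Type*} [Field k] {n : ℕ} (I : Ideal (MvPolynomial (Fin n) k))
    (γ : Fin n → ℤ) : Submodule k (MvPolynomial (Fin n) k ⧸ I) :=
  (polyPiece k γ).map (Ideal.Quotient.mkₐ k I).toLinearMap

/-- The space `T(I) = Hom_S(I, S ⧸ I)`, where `S = k[x₁, …, xₙ]`. -/
abbrev TangentSpaceAt {k : Type*} [Field k] {n : ℕ} (I : Ideal (MvPolynomial (Fin n) k)) : Type _ :=
  I →ₗ[MvPolynomial (Fin n) k] (MvPolynomial (Fin n) k ⧸ I)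

/-- The graded component of degree `α ∈ ℤⁿ` of `T(I)`: the `S`-linear maps `I → S ⧸ I` that send
every element of `I` that is homogeneous of degree `β` into degree `α + β`, for all `β`. -/
def tangentPiece {k : Type*} [Field k] {n : ℕ} (I : Ideal (MvPolynomial (Fin n) k))
    (α : Fin n → ℤ) : Submodule k (TangentSpaceAt I) where
  carrier := {φ | ∀ (β : Fin n → ℤ) (f : I),
    (f : MvPolynomial (Fin n) k) ∈ polyPiece k β → φ f ∈ quotientPiece I (α + β)}
  add_mem' hφ hψ β f hf := Submodule.add_mem _ (hφ β f hf) (hψ β f hf)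
  zero_mem' _ _ _ := Submodule.zero_mem _
  smul_mem' c _ hφ β f hf := Submodule.smul_mem _ c (hφ β f hf)

/-- The subspace `T_s(I)` of `T(I)`: the sum of the graded components of `T(I)` in the degrees
whose signs are prescribed by `s`. (Components of different degrees of a monomial ideal are
independent, so that this sum inside `T(I)` is direct.) -/
noncomputable def tangentSignature {k : Type*} [Field k] {n : ℕ}
    (I : Ideal (MvPolynomial (Fin n) k)) (s : Fin n → SignLetter) :
    Submodule k (TangentSpaceAt I) :=
  ⨆ α ∈ signatureDegrees s, tangentPiece I α

/-! Let `L` be the finite set of exponents of monomials outside I, so that |L| = d. Behind the proof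
is the Koszul complex of End_k(S/I), which computes Ext_S(S/I, S/I). In degree α its terms K⁰, K¹,
K², K³ have bases given by pairs of points of L with difference α + e_A, where A ranges over subsets
of {1,2,3} of size 0, 1, 2, 3. If α has a negative coordinate, then S/I and Hom(S/I, S/I) vanish in
degree α, and |T(I)|_α is Ext¹ in that degree.

The argument uses this without Ext groups. A homomorphism is a function c off L, an element of K⁰ is
a function b on L, and gluing them gives a function on ℕ³ whose differences form a closed element of
K¹. When α has a negative coordinate, this identifies |T(I)|_α ⊕ K⁰ with ker(K¹ → K²)
(`koszulDifferential_injective`, `range_koszulDifferential`), by summing along a direction in which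
α is negative (`IsStaircase.exists_primitive`).

Swapping the two points of a pair identifies the map K¹ → K² in degree -1-α with the transpose of
the one in degree α, a form of Serre duality (`koszulMatrix_duality`). The ranks agree over any
field, so if α and -1-α both have a negative coordinate, dim|T|_α - dim|T|_{-1-α} is an alternating
count of pairs, namely -χ(K) (`finrank_homSpace_sub`).

Now sum over the degrees of a nonconstant signature; α ↦ -1-α reverses the signature. A pair with
difference δ contributes a product over coordinates of first differences of indicators of
half-lines, which vanishes unless δ = 0 (`signatureIndicator_euler`). Only the d diagonal pairs
survive, each contributing a sign. Parity follows because the signatures ppp and nnn contribute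
nothing and the other six fall into three opposite pairs. -/

/-- The `i`-th unit vector of `ℤⁿ`. -/
def latticeUnit {n : ℕ} (i : Fin n) : Fin n → ℤ := Pi.single i 1

lemma latticeUnit_self {n : ℕ} (i : Fin n) : latticeUnit i i = 1 := by simp [latticeUnit]

lemma latticeUnit_of_ne {n : ℕ} {i j : Fin n} (h : j ≠ i) : latticeUnit i j = 0 := by
  simp [latticeUnit, h]

lemma latticeUnit_nonneg {n : ℕ} (i : Fin n) : 0 ≤ latticeUnit i := by
  intro j
  by_cases h : j = i
  · subst h; simp [latticeUnit_self]
  · simp [latticeUnit_of_ne h]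

lemma add_latticeUnit_nonneg {n : ℕ} {v : Fin n → ℤ} (hv : 0 ≤ v) (i : Fin n) :
    0 ≤ v + latticeUnit i := add_nonneg hv (latticeUnit_nonneg i)

lemma nonneg_sub_latticeUnit {n : ℕ} {v : Fin n → ℤ} (hv : 0 ≤ v) {i : Fin n} (hi : 1 ≤ v i) :
    0 ≤ v - latticeUnit i := by
  intro j
  have := hv j
  by_cases h : j = i
  · subst h; simpa [latticeUnit_self] using hi
  · simpa [latticeUnit_of_ne h] using this

/-! ### Staircases and discrete integration. -/

/-- A finite order ideal of `ℕⁿ`, viewed inside `ℤⁿ`. -/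
structure IsStaircase {n : ℕ} (L : Finset (Fin n → ℤ)) : Prop where
  nonneg : ∀ v ∈ L, 0 ≤ v
  mem_of_le : ∀ v ∈ L, ∀ w, 0 ≤ w → w ≤ v → w ∈ L

namespace IsStaircase

variable {n : ℕ} {L : Finset (Fin n → ℤ)}

lemma notMem_add (hL : IsStaircase L) {v : Fin n → ℤ} (hv : 0 ≤ v) (hvL : v ∉ L) (i : Fin n) :
    v + latticeUnit i ∉ L := fun h =>
  hvL (hL.mem_of_le _ h _ hv (le_add_of_nonneg_right (latticeUnit_nonneg i)))

/-- If a translate of `v` by a unit vector lies in the staircase but `v` does not, then the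
corresponding coordinate of `v` is negative. -/
lemma neg_of_add_mem (hL : IsStaircase L) {v : Fin n → ℤ} {i : Fin n}
    (h : v + latticeUnit i ∈ L) (hv : v ∉ L) : v i < 0 := by
  by_contra hi
  refine hv (hL.mem_of_le _ h _ ?_ (le_add_of_nonneg_right (latticeUnit_nonneg i)))
  intro j
  by_cases hj : j = i
  · subst hj; exact not_lt.mp hi
  · simpa [latticeUnit_of_ne hj] using hL.nonneg _ h j

lemma coord_nonneg (hL : IsStaircase L) {v : Fin n → ℤ} (hv : v ∈ L) (i : Fin n) : 0 ≤ v i :=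
  hL.nonneg v hv i

/-- A function that is constant along a direction in which the degree is negative vanishes. -/
lemma eq_zero_of_shift_invariant {k : Type*} [Zero k] (hL : IsStaircase L) {α : Fin n → ℤ}
    {i : Fin n} (hα : α i < 0) {h : (Fin n → ℤ) → k}
    (hsupp : ∀ v, h v ≠ 0 → 0 ≤ v ∧ v + α ∈ L)
    (hinv : ∀ v, 0 ≤ v → v + α + latticeUnit i ∈ L → h v = h (v + latticeUnit i)) : h = 0 := by
  -- If h v ≠ 0, then v_i + α_i ≥ 0 and α_i < 0 give v_i ≥ 1, so v - e_i is still nonnegative and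
  -- carries the same value. This descent on v_i cannot continue forever.
  have key : ∀ m : ℕ, ∀ v : Fin n → ℤ, v i ≤ (m : ℤ) → h v = 0 := by
    intro m
    induction m with
    | zero =>
      intro v hv
      by_contra hne
      have h1 := hL.coord_nonneg (hsupp v hne).2 i
      simp only [Pi.add_apply] at h1
      push_cast at hv
      omega
    | succ m ih =>
      intro v hv
      by_contra hne
      obtain ⟨h0, h2⟩ := hsupp v hne
      have h1 := hL.coord_nonneg h2 i
      simp only [Pi.add_apply] at h1
      have hw : 0 ≤ v - latticeUnit i := nonneg_sub_latticeUnit h0 (by omega)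
      have h3 := hinv (v - latticeUnit i) hw (by
        convert h2 using 1; abel)
      rw [sub_add_cancel] at h3
      refine hne (h3 ▸ ih _ ?_)
      simp only [Pi.sub_apply, latticeUnit_self]
      push_cast at hv
      omega
  funext v
  exact key (v i).toNat v (Int.self_le_toNat _)

/-- Integration in a direction in which the degree is negative. -/
lemma exists_primitive_direction {k : Type*} [AddCommGroup k] (hL : IsStaircase L)
    {α : Fin n → ℤ} {i : Fin n} (A : (Fin n → ℤ) → k)
    (hA : ∀ v, A v ≠ 0 → 0 ≤ v ∧ v + α + latticeUnit i ∈ L) :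
    ∃ h : (Fin n → ℤ) → k, (∀ v, h v ≠ 0 → 0 ≤ v ∧ v + α ∈ L) ∧
      ∀ v, 0 ≤ v → v + α + latticeUnit i ∈ L → h v - h (v + latticeUnit i) = A v := by
  classical
  -- Sum of A along the ray from v back to the face v_i = 0; the minus sign matches the convention
  -- h(v) - h(v + e_i).
  let g : (Fin n → ℤ) → k := fun v =>
    -∑ t ∈ Finset.range (v i).toNat, A (v - ((t : ℤ) + 1) • latticeUnit i)
  have hg : ∀ v, 0 ≤ v → g v - g (v + latticeUnit i) = A v := by
    intro v hv
    have h1 : ((v + latticeUnit i) i).toNat = (v i).toNat + 1 := by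
      have := hv i
      simp only [Pi.zero_apply] at this
      simp only [Pi.add_apply, latticeUnit_self]
      omega
    simp only [g, h1, Finset.sum_range_succ']
    have h2 : ∀ t : ℕ, v + latticeUnit i - (((t + 1 : ℕ) : ℤ) + 1) • latticeUnit i
        = v - ((t : ℤ) + 1) • latticeUnit i := by
      intro t; push_cast; module
    have h3 : v + latticeUnit i - (((0 : ℕ) : ℤ) + 1) • latticeUnit i = v := by
      push_cast; module
    simp only [h2, h3]
    abel
  -- A nonzero term would need v + α - t e_i in L. Hence truncating g to v + α ∈ L does not disturb
  -- the equation: v + α can be missing from L while v + α + e_i is in it only through a negative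
  -- i-th coordinate.
  have hgneg : ∀ v, (v + α) i < 0 → g v = 0 := by
    intro v hv
    simp only [g, neg_eq_zero]
    refine Finset.sum_eq_zero fun t _ => ?_
    by_contra hne
    have := hL.coord_nonneg (hA _ hne).2 i
    simp only [Pi.add_apply, Pi.sub_apply, Pi.smul_apply, latticeUnit_self, smul_eq_mul] at this hv
    omega
  have hgpos : ∀ v, g v ≠ 0 → 0 ≤ v := by
    intro v hv
    have hi : 0 ≤ v i := by
      by_contra hneg
      apply hv
      simp only [g]
      rw [Int.toNat_of_nonpos (by omega)]
      simp
    intro j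
    by_cases hj : j = i
    · subst hj; exact hi
    by_contra hneg
    apply hv
    simp only [g, neg_eq_zero]
    refine Finset.sum_eq_zero fun t _ => ?_
    by_contra hne
    apply hneg
    simpa [latticeUnit_of_ne hj] using (hA _ hne).1 j
  refine ⟨fun v => if v + α ∈ L then g v else 0, fun v hv => ?_, fun v hv hvL => ?_⟩
  · have hv' : v + α ∈ L := by
      by_contra h; exact hv (by simp [h])
    exact ⟨hgpos v (by simpa [hv'] using hv), hv'⟩
  · have h1 : v + latticeUnit i + α ∈ L := by
      convert hvL using 1; abel
    simp only [h1, if_true]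
    rw [← hg v hv]
    congr 1
    split_ifs with h2
    · rfl
    · exact (hgneg v (hL.neg_of_add_mem hvL h2)).symm

/-- Integration of a closed system of differences in a degree with a negative coordinate. -/
lemma exists_primitive {k : Type*} [AddCommGroup k] (hL : IsStaircase L)
    {α : Fin n → ℤ} {i : Fin n} (hα : α i < 0) (A : Fin n → (Fin n → ℤ) → k)
    (hA : ∀ j v, A j v ≠ 0 → v ∈ L ∧ v + α + latticeUnit j ∈ L)
    (hclosed : ∀ j l, j ≠ l → ∀ v ∈ L, v + α + latticeUnit j + latticeUnit l ∈ L →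
      A j v - A j (v + latticeUnit l) = A l v - A l (v + latticeUnit j)) :
    ∃ h : (Fin n → ℤ) → k, (∀ v, h v ≠ 0 → 0 ≤ v ∧ v + α ∈ L) ∧
      ∀ j v, 0 ≤ v → v + α + latticeUnit j ∈ L → h v - h (v + latticeUnit j) = A j v := by
  classical
  obtain ⟨h, hsupp, hdiff⟩ := hL.exists_primitive_direction (α := α) (i := i) (A i)
    fun v hv => ⟨hL.nonneg _ (hA i v hv).1, (hA i v hv).2⟩
  refine ⟨h, hsupp, fun j => ?_⟩
  by_cases hji : j = i
  · subst hji; exact hdiff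
  -- A negative j-th coordinate of v + α is unchanged by adding e_i, so in the second case all three
  -- terms vanish.
  have hdiff' : ∀ v, 0 ≤ v → v + α + latticeUnit i ∈ L ∨ (v + α) j < 0 →
      h v - h (v + latticeUnit i) = A i v := by
    rintro v hv (hv' | hv')
    · exact hdiff v hv hv'
    · have e1 : h v = 0 := by
        by_contra hne
        exact absurd (hL.coord_nonneg (hsupp v hne).2 j) (not_le.mpr hv')
      have e2 : h (v + latticeUnit i) = 0 := by
        by_contra hne
        have := hL.coord_nonneg (hsupp _ hne).2 j
        simp only [Pi.add_apply, latticeUnit_of_ne hji] at this hv'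
        omega
      have e3 : A i v = 0 := by
        by_contra hne
        have := hL.coord_nonneg (hA i _ hne).2 j
        simp only [Pi.add_apply, latticeUnit_of_ne hji] at this hv'
        omega
      rw [e1, e2, e3, sub_zero]
  -- The defect of the equation in direction j. Closedness makes it invariant along e_i, and it
  -- lives in degree α + e_j, whose i-th coordinate is still negative, so it vanishes by descent.
  let g : (Fin n → ℤ) → k := fun v =>
    if 0 ≤ v ∧ v + α + latticeUnit j ∈ L then h v - h (v + latticeUnit j) - A j v else 0
  have hg0 : g = 0 := by
    refine hL.eq_zero_of_shift_invariant (α := α + latticeUnit j) (i := i) ?_ ?_ ?_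
    · simpa [latticeUnit_of_ne (Ne.symm hji)] using hα
    · intro v hv
      by_contra hne
      rw [← add_assoc] at hne
      exact hv (by simp [g, hne])
    · intro v hv hvL
      have hvL1 : v + latticeUnit i + α + latticeUnit j ∈ L := by
        convert hvL using 1; abel
      have hvL2 : v + α + latticeUnit i + latticeUnit j ∈ L := by
        convert hvL using 1; abel
      have hvL3 : v + latticeUnit j + α + latticeUnit i ∈ L := by
        convert hvL using 1; abel
      have hvL4 : v + α + latticeUnit j + latticeUnit i ∈ L := by
        convert hvL using 1; abel
      have e1 : g v = h v - h (v + latticeUnit j) - A j v := by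
        by_cases hc : v + α + latticeUnit j ∈ L
        · simp [g, hv, hc]
        have hneg := hL.neg_of_add_mem hvL4 hc
        simp only [Pi.add_apply, latticeUnit_of_ne (Ne.symm hji)] at hneg
        have e1 : h v = 0 := by
          by_contra hne
          have := hL.coord_nonneg (hsupp v hne).2 i
          simp only [Pi.add_apply] at this
          omega
        have e2 : h (v + latticeUnit j) = 0 := by
          by_contra hne
          have := hL.coord_nonneg (hsupp _ hne).2 i
          simp only [Pi.add_apply, latticeUnit_of_ne (Ne.symm hji)] at this
          omega
        have e3 : A j v = 0 := by
          by_contra hne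
          exact hc (hA j v hne).2
        simp [g, hc, e1, e2, e3]
      have e2 : g (v + latticeUnit i) = h (v + latticeUnit i)
          - h (v + latticeUnit j + latticeUnit i) - A j (v + latticeUnit i) := by
        simp only [g, hvL1, add_latticeUnit_nonneg hv i, and_self, if_true]
        rw [add_right_comm v]
      have d1 : h v - h (v + latticeUnit i) = A i v := by
        refine hdiff' v hv ?_
        by_cases hc : v + α + latticeUnit i ∈ L
        · exact Or.inl hc
        · right
          have := hL.neg_of_add_mem hvL2 hc
          simpa [latticeUnit_of_ne hji] using this
      have d2 := hdiff (v + latticeUnit j) (add_latticeUnit_nonneg hv j) hvL3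
      have d3 : A j v - A j (v + latticeUnit i) = A i v - A i (v + latticeUnit j) := by
        by_cases hc : v ∈ L
        · exact hclosed j i hji v hc hvL4
        · have z : ∀ l w, w ∉ L → A l w = 0 := fun l w hw => by
            by_contra hne; exact hw (hA l w hne).1
          rw [z j v hc, z i v hc, z j _ (hL.notMem_add hv hc i), z i _ (hL.notMem_add hv hc j)]
      rw [e1, e2]
      have : h v - h (v + latticeUnit j) - A j v - (h (v + latticeUnit i)
          - h (v + latticeUnit j + latticeUnit i) - A j (v + latticeUnit i)) = 0 := by
        have : h v - h (v + latticeUnit j) - A j v - (h (v + latticeUnit i)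
            - h (v + latticeUnit j + latticeUnit i) - A j (v + latticeUnit i))
            = (h v - h (v + latticeUnit i)) - (h (v + latticeUnit j)
              - h (v + latticeUnit j + latticeUnit i)) - (A j v - A j (v + latticeUnit i)) := by
          abel
        rw [this, d1, d2, d3, sub_self]
      exact sub_eq_zero.mp this
  intro v hv hvL
  have := congrFun hg0 v
  simp only [g, hv, hvL, and_self, if_true, Pi.zero_apply] at this
  exact sub_eq_zero.mp this

end IsStaircase

/-! ### Graded homomorphisms as functions off the staircase. -/

/-- The combinatorial model of the degree `α` part of `Hom(I, S ⧸ I)`, where `L` is the staircase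
of `I`: the functions giving the coefficient of `x^{u+α}` in the image of `x^u`. -/
def homSpace (k : Type*) [Field k] {n : ℕ} (L : Finset (Fin n → ℤ)) (α : Fin n → ℤ) :
    Submodule k ((Fin n → ℤ) → k) where
  carrier := {c | (∀ u, c u ≠ 0 → 0 ≤ u ∧ u ∉ L ∧ u + α ∈ L) ∧
    -- Compatibility with x_i has content only if the target monomial survives in S/I. The point u +
    -- α itself may lie outside L; then c u = 0, which forces c(u + e_i) = 0.
    ∀ u i, 0 ≤ u → u ∉ L → u + α + latticeUnit i ∈ L → c u = c (u + latticeUnit i)}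
  zero_mem' := by simp
  add_mem' := by
    rintro a b ⟨ha, ha'⟩ ⟨hb, hb'⟩
    refine ⟨fun u hu => ?_, fun u i h1 h2 h3 => ?_⟩
    · by_cases h : a u = 0
      · exact hb u (by simpa [h] using hu)
      · exact ha u h
    · simp only [Pi.add_apply, ha' u i h1 h2 h3, hb' u i h1 h2 h3]
  smul_mem' := by
    rintro r a ⟨ha, ha'⟩
    refine ⟨fun u hu => ha u fun h => hu (by simp [h]), fun u i h1 h2 h3 => ?_⟩
    simp only [Pi.smul_apply, ha' u i h1 h2 h3]

section homSpace

variable {k : Type*} [Field k] {n : ℕ} {L : Finset (Fin n → ℤ)}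

instance homSpace_finite (α : Fin n → ℤ) : Module.Finite k (homSpace k L α) := by
  let f : homSpace k L α →ₗ[k] (L → k) :=
    { toFun := fun c v => c.1 (v.1 - α)
      map_add' := fun _ _ => rfl
      map_smul' := fun _ _ => rfl }
  refine Module.Finite.of_injective f fun c c' h => Subtype.ext (funext fun u => ?_)
  by_cases hu : u + α ∈ L
  · simpa [f] using congrFun h ⟨u + α, hu⟩
  · have z : ∀ c : homSpace k L α, c.1 u = 0 := fun c => by
      by_contra hne; exact hu (c.2.1 u hne).2.2
    rw [z, z]

/-- There are no nonzero homomorphisms in degrees with nonnegative coordinates. -/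
lemma IsStaircase.homSpace_eq_bot_of_nonneg (hL : IsStaircase L) {α : Fin n → ℤ} (hα : 0 ≤ α) :
    homSpace k L α = ⊥ := by
  rw [eq_bot_iff]
  intro c hc
  rw [Submodule.mem_bot]
  funext u
  by_contra hne
  obtain ⟨h0, h1, h2⟩ := hc.1 u hne
  exact h1 (hL.mem_of_le _ h2 _ h0 (le_add_of_nonneg_right hα))

/-- Finiteness of L makes every ray leave it; the first exit time is used. -/
lemma exists_last_mem {v : Fin n → ℤ} (hv : v ∈ L) (i : Fin n) :
    ∃ t : ℕ, (∀ s : ℕ, s ≤ t → v + (s : ℤ) • latticeUnit i ∈ L) ∧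
      v + (t : ℤ) • latticeUnit i + latticeUnit i ∉ L := by
  classical
  have hex : ∃ t : ℕ, v + (t : ℤ) • latticeUnit i + latticeUnit i ∉ L := by
    by_contra! hcon
    have hinj : Function.Injective fun t : ℕ => v + (t : ℤ) • latticeUnit i + latticeUnit i := by
      intro a b hab
      have := congrFun hab i
      simp only [Pi.add_apply, Pi.smul_apply, latticeUnit_self, smul_eq_mul] at this
      omega
    exact Set.infinite_range_of_injective hinj
      (L.finite_toSet.subset (Set.range_subset_iff.mpr hcon))
  refine ⟨Nat.find hex, fun s hs => ?_, Nat.find_spec hex⟩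
  rcases s with _ | s
  · simpa using hv
  · have := Nat.find_min hex (m := s) (by omega)
    rw [not_not] at this
    convert this using 1
    push_cast
    module

/-- There are no nonzero homomorphisms in degrees with negative coordinates, in at least two
variables. -/
lemma IsStaircase.homSpace_eq_bot_of_neg (hL : IsStaircase L) {α : Fin n → ℤ}
    (hα : ∀ i, α i < 0) {i j : Fin n} (hij : i ≠ j) : homSpace k L α = ⊥ := by
  rw [eq_bot_iff]
  intro c hc
  rw [Submodule.mem_bot]
  -- From a point with c u ≠ 0, slide along e_i, keeping the value, until u + α is about to leave L;
  -- then one can step back by e_j without entering L. This lowers the j-th coordinate, which u + α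
  -- ≥ 0 bounds below.
  have key : ∀ m : ℕ, ∀ u : Fin n → ℤ, u j + α j < m → c u = 0 := by
    intro m
    induction m with
    | zero =>
      intro u hu
      by_contra hne
      have := hL.coord_nonneg (hc.1 u hne).2.2 j
      simp only [Pi.add_apply] at this
      push_cast at hu
      omega
    | succ m ih =>
      intro u hu
      by_contra hne
      obtain ⟨h0, h1, h2⟩ := hc.1 u hne
      obtain ⟨t, ht, ht'⟩ := exists_last_mem h2 i
      have hnn : ∀ s : ℕ, 0 ≤ u + (s : ℤ) • latticeUnit i := fun s =>
        add_nonneg h0 (smul_nonneg (Int.natCast_nonneg s) (latticeUnit_nonneg i))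
      have hconst : ∀ s : ℕ, s ≤ t → c (u + (s : ℤ) • latticeUnit i) = c u := by
        intro s
        induction s with
        | zero => intro _; simp
        | succ s ihs =>
          intro hs
          rw [← ihs (by omega)]
          have e : u + ((s + 1 : ℕ) : ℤ) • latticeUnit i
              = u + (s : ℤ) • latticeUnit i + latticeUnit i := by push_cast; module
          rw [e]
          refine (hc.2 _ i (hnn s) ?_ ?_).symm
          · exact fun hmem => h1 (hL.mem_of_le _ hmem _ h0 (le_add_of_nonneg_right
              (smul_nonneg (Int.natCast_nonneg s) (latticeUnit_nonneg i))))
          · convert ht (s + 1) hs using 1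
            push_cast; module
      set w := u + (t : ℤ) • latticeUnit i with hw
      -- The left side lies just outside L. The inequality uses α_i ≤ -1 to absorb e_i and α_j ≤ -1
      -- to absorb -e_j, so w - e_j is nonnegative and outside L too.
      have hle : u + α + (t : ℤ) • latticeUnit i + latticeUnit i ≤ w - latticeUnit j := by
        intro l
        have := hα l
        by_cases hl : l = j
        · subst hl
          simp only [hw, Pi.add_apply, Pi.sub_apply, Pi.smul_apply, latticeUnit_self,
            latticeUnit_of_ne (Ne.symm hij), smul_eq_mul]
          omega
        · by_cases hl' : l = i
          · subst hl'
            simp only [hw, Pi.add_apply, Pi.sub_apply, Pi.smul_apply, latticeUnit_self,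
              latticeUnit_of_ne hl, smul_eq_mul]
            omega
          · simp only [hw, Pi.add_apply, Pi.sub_apply, Pi.smul_apply, latticeUnit_of_ne hl,
              latticeUnit_of_ne hl', smul_eq_mul]
            omega
      have hp0 : 0 ≤ u + α + (t : ℤ) • latticeUnit i + latticeUnit i :=
        add_latticeUnit_nonneg (hL.nonneg _ (ht t le_rfl)) i
      have hnw : w - latticeUnit j ∉ L := fun hmem => ht' (hL.mem_of_le _ hmem _ hp0 hle)
      have step := hc.2 (w - latticeUnit j) j (hp0.trans hle) hnw (by
        convert ht t le_rfl using 1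
        rw [hw]; abel)
      rw [sub_add_cancel, hw, hconst t le_rfl] at step
      apply hne
      rw [← step]
      apply ih
      simp only [Pi.add_apply, Pi.sub_apply, Pi.smul_apply, latticeUnit_self,
        latticeUnit_of_ne (Ne.symm hij), smul_eq_mul]
      push_cast at hu
      omega
  funext u
  exact key (u j + α j + 1).toNat u (by omega)

end homSpace

/-! ### The Koszul complex and its duality. -/

/-- The exponents of the staircase whose translate by `β` lies in the staircase. -/
def overlap {n : ℕ} (L : Finset (Fin n → ℤ)) (β : Fin n → ℤ) : Finset (Fin n → ℤ) :=
  L.filter fun v => v + β ∈ L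

/-- The indices of the first term of the Koszul complex of `End(S ⧸ I)` in degree `α`. -/
def koszulIndexOne (L : Finset (Fin 3 → ℤ)) (α : Fin 3 → ℤ) : Finset (Fin 3 × (Fin 3 → ℤ)) :=
  (Finset.univ ×ˢ L).filter fun p => p.2 + α + latticeUnit p.1 ∈ L

/-- The indices of the second term of the Koszul complex of `End(S ⧸ I)` in degree `α`. -/
def koszulIndexTwo (L : Finset (Fin 3 → ℤ)) (α : Fin 3 → ℤ) : Finset (Fin 3 × (Fin 3 → ℤ)) :=
  (Finset.univ ×ˢ L).filter fun p => p.2 + α + 1 - latticeUnit p.1 ∈ L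

/-- The indicator of equality, as an entry of a matrix. -/
def kronecker (k : Type*) [Field k] {ι : Type*} [DecidableEq ι] (p q : ι) : k :=
  if p = q then 1 else 0

/-- The differential from the first to the second term of the Koszul complex of `End(S ⧸ I)` in
degree `α`. -/
def koszulMatrix (k : Type*) [Field k] (L : Finset (Fin 3 → ℤ)) (α : Fin 3 → ℤ) :
    Matrix (koszulIndexTwo L α) (koszulIndexOne L α) k := fun q p =>
  kronecker k p.1 (q.1.1 + 1, q.1.2)
    - kronecker k p.1 (q.1.1 + 1, q.1.2 + latticeUnit (q.1.1 + 2))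
    - kronecker k p.1 (q.1.1 + 2, q.1.2)
    + kronecker k p.1 (q.1.1 + 2, q.1.2 + latticeUnit (q.1.1 + 1))

lemma mem_koszulIndexOne {L : Finset (Fin 3 → ℤ)} {α : Fin 3 → ℤ} {p : Fin 3 × (Fin 3 → ℤ)} :
    p ∈ koszulIndexOne L α ↔ p.2 ∈ L ∧ p.2 + α + latticeUnit p.1 ∈ L := by
  simp [koszulIndexOne]

lemma mem_koszulIndexTwo {L : Finset (Fin 3 → ℤ)} {α : Fin 3 → ℤ} {p : Fin 3 × (Fin 3 → ℤ)} :
    p ∈ koszulIndexTwo L α ↔ p.2 ∈ L ∧ p.2 + α + 1 - latticeUnit p.1 ∈ L := by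
  simp [koszulIndexTwo]

/-- Duality between the first term of the Koszul complex in degree `α` and the second term in
degree `-1 - α`. -/
def koszulDuality (L : Finset (Fin 3 → ℤ)) (α α' : Fin 3 → ℤ) (h : α + α' + 1 = 0) :
    koszulIndexOne L α ≃ koszulIndexTwo L α' where
  toFun p := ⟨(p.1.1, p.1.2 + α + latticeUnit p.1.1), by
    obtain ⟨⟨i, v⟩, hp⟩ := p
    rw [mem_koszulIndexOne] at hp
    rw [mem_koszulIndexTwo]
    refine ⟨hp.2, ?_⟩
    convert hp.1 using 1
    linear_combination h⟩
  invFun q := ⟨(q.1.1, q.1.2 + α' + 1 - latticeUnit q.1.1), by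
    obtain ⟨⟨i, v⟩, hq⟩ := q
    rw [mem_koszulIndexTwo] at hq
    rw [mem_koszulIndexOne]
    refine ⟨hq.2, ?_⟩
    convert hq.1 using 1
    linear_combination h⟩
  left_inv := by
    rintro ⟨⟨i, v⟩, hp⟩
    ext1
    refine Prod.ext rfl ?_
    linear_combination h
  right_inv := by
    rintro ⟨⟨i, v⟩, hp⟩
    ext1
    refine Prod.ext rfl ?_
    linear_combination h

lemma sum_latticeUnit : latticeUnit (0 : Fin 3) + latticeUnit 1 + latticeUnit 2 = 1 := by
  funext l
  fin_cases l <;> simp [latticeUnit]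

lemma latticeUnit_cyclic (i : Fin 3) :
    latticeUnit i + latticeUnit (i + 1) + latticeUnit (i + 2) = 1 := by
  rw [← sum_latticeUnit]
  fin_cases i
  · rfl
  · change latticeUnit (1 : Fin 3) + latticeUnit 2 + latticeUnit 0 = _; abel
  · change latticeUnit (2 : Fin 3) + latticeUnit 0 + latticeUnit 1 = _; abel

lemma kronecker_congr {k : Type*} [Field k] {ι κ : Type*} [DecidableEq ι] [DecidableEq κ]
    {p q : ι} {p' q' : κ} (h : p = q ↔ p' = q') : kronecker k p q = kronecker k p' q' := by
  simp only [kronecker, h]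

lemma fin_three_eq_add_one_iff {j l : Fin 3} : j = l + 1 ↔ l = j + 2 := by revert j l; decide

/-- Duality exchanges the first and fourth terms of a matrix entry, and the second and third.
Exchanged terms have equal signs, so with cyclic indexing the transpose appears with no sign
correction. -/
lemma koszulMatrix_duality (k : Type*) [Field k] (L : Finset (Fin 3 → ℤ)) {α α' : Fin 3 → ℤ}
    (h : α + α' + 1 = 0) (h' : α' + α + 1 = 0) (q : koszulIndexTwo L α)
    (p : koszulIndexOne L α) :
    koszulMatrix k L α' (koszulDuality L α α' h p) ((koszulDuality L α' α h').symm q)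
      = koszulMatrix k L α q p := by
  obtain ⟨⟨l, v⟩, hq⟩ := q
  obtain ⟨⟨j, w⟩, hp⟩ := p
  simp only [koszulMatrix, koszulDuality, Equiv.coe_fn_mk, Equiv.coe_fn_symm_mk]
  have t1 : kronecker k (j, w) (l + 1, v) = kronecker k (l, v + α + 1 - latticeUnit l)
      (j + 2, w + α + latticeUnit j + latticeUnit (j + 1)) := by
    apply kronecker_congr
    simp only [Prod.mk.injEq, fin_three_eq_add_one_iff]
    refine and_congr_right fun hl => ?_
    have hc := latticeUnit_cyclic j
    subst hl
    rw [eq_comm]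
    exact ⟨fun e => by linear_combination e - hc, fun e => by linear_combination e + hc⟩
  have t2 : kronecker k (j, w) (l + 1, v + latticeUnit (l + 2))
      = kronecker k (l, v + α + 1 - latticeUnit l) (j + 2, w + α + latticeUnit j) := by
    apply kronecker_congr
    simp only [Prod.mk.injEq, fin_three_eq_add_one_iff]
    refine and_congr_right fun hl => ?_
    have hc := latticeUnit_cyclic l
    rw [← fin_three_eq_add_one_iff] at hl
    subst hl
    rw [eq_comm]
    exact ⟨fun e => by linear_combination e - hc, fun e => by linear_combination e + hc⟩
  have t3 : kronecker k (j, w) (l + 2, v) = kronecker k (l, v + α + 1 - latticeUnit l)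
      (j + 1, w + α + latticeUnit j + latticeUnit (j + 2)) := by
    apply kronecker_congr
    simp only [Prod.mk.injEq, ← fin_three_eq_add_one_iff]
    refine and_congr_right fun hl => ?_
    have hc := latticeUnit_cyclic j
    subst hl
    rw [eq_comm]
    exact ⟨fun e => by linear_combination e - hc, fun e => by linear_combination e + hc⟩
  have t4 : kronecker k (j, w) (l + 2, v + latticeUnit (l + 1))
      = kronecker k (l, v + α + 1 - latticeUnit l) (j + 1, w + α + latticeUnit j) := by
    apply kronecker_congr
    simp only [Prod.mk.injEq, ← fin_three_eq_add_one_iff]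
    refine and_congr_right fun hl => ?_
    have hc := latticeUnit_cyclic l
    rw [fin_three_eq_add_one_iff] at hl
    subst hl
    rw [eq_comm]
    exact ⟨fun e => by linear_combination e - hc, fun e => by linear_combination e + hc⟩
  rw [t1, t2, t3, t4]
  ring

/-- The ranks of the middle Koszul differential agree in complementary degrees. -/
lemma rank_koszulMatrix_eq (k : Type*) [Field k] (L : Finset (Fin 3 → ℤ)) {α α' : Fin 3 → ℤ}
    (h : α + α' + 1 = 0) : (koszulMatrix k L α').rank = (koszulMatrix k L α).rank := by
  have h' : α' + α + 1 = 0 := by rw [add_comm α' α]; exact h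
  have e : (koszulMatrix k L α).transpose = (koszulMatrix k L α').submatrix
      (koszulDuality L α α' h) (koszulDuality L α' α h').symm := by
    ext p q
    rw [Matrix.transpose_apply, Matrix.submatrix_apply, koszulMatrix_duality k L h h']
  rw [← Matrix.rank_transpose (koszulMatrix k L α), e]
  exact (Matrix.rank_submatrix _ (koszulDuality L α α' h) (koszulDuality L α' α h').symm).symm

lemma card_koszulIndexOne (L : Finset (Fin 3 → ℤ)) (α : Fin 3 → ℤ) :
    (koszulIndexOne L α).card = ∑ i, (overlap L (α + latticeUnit i)).card := by
  classical
  rw [koszulIndexOne, Finset.card_filter, Finset.sum_product]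
  simp only [overlap, Finset.card_filter, add_assoc]

/-- Swap the two points of each pair. -/
lemma card_overlap_neg {n : ℕ} (L : Finset (Fin n → ℤ)) {α β : Fin n → ℤ} (h : α + β = 0) :
    (overlap L α).card = (overlap L β).card := by
  refine Finset.card_bij' (fun v _ => v + α) (fun v _ => v + β) ?_ ?_ ?_ ?_
  · intro v hv
    simp only [overlap, Finset.mem_filter] at hv ⊢
    rw [add_assoc, h, add_zero]; exact hv.symm
  · intro v hv
    simp only [overlap, Finset.mem_filter] at hv ⊢
    rw [add_assoc, add_comm β, h, add_zero]; exact hv.symm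
  · intro v _; simp only [add_assoc, h, add_zero]
  · intro v _; simp only [add_assoc, add_comm β, h, add_zero]

/-- Extension of a function on a finite set by zero. -/
def extendZero {k : Type*} [Field k] {ι : Type*} [DecidableEq ι] (s : Finset ι) :
    (s → k) →ₗ[k] (ι → k) where
  toFun b i := if h : i ∈ s then b ⟨i, h⟩ else 0
  map_add' a b := by
    ext i
    by_cases h : i ∈ s <;> simp [h]
  map_smul' r b := by
    ext i
    by_cases h : i ∈ s <;> simp [h]

section extendZero

variable {k : Type*} [Field k] {ι : Type*} [DecidableEq ι] {s : Finset ι}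

lemma extendZero_mem (b : s → k) {i : ι} (h : i ∈ s) : extendZero s b i = b ⟨i, h⟩ := by
  simp [extendZero, h]

lemma extendZero_notMem (b : s → k) {i : ι} (h : i ∉ s) : extendZero s b i = 0 := by
  simp [extendZero, h]

lemma mem_of_extendZero_ne_zero {b : s → k} {i : ι} (h : extendZero s b i ≠ 0) : i ∈ s := by
  by_contra hi
  exact h (extendZero_notMem b hi)

lemma sum_kronecker_mul (b : s → k) (i : ι) :
    ∑ p : s, kronecker k p.1 i * b p = extendZero s b i := by
  by_cases h : i ∈ s
  · rw [extendZero_mem b h, Finset.sum_eq_single (⟨i, h⟩ : s)]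
    · simp [kronecker]
    · intro p _ hp
      have : p.1 ≠ i := fun e => hp (Subtype.ext e)
      simp [kronecker, this]
    · simp
  · rw [extendZero_notMem b h]
    refine Finset.sum_eq_zero fun p _ => ?_
    have : p.1 ≠ i := fun e => h (e ▸ p.2)
    simp [kronecker, this]

end extendZero

/-! ### Homomorphisms as Koszul cocycles, and the dimension formula. -/

section Koszul

variable {k : Type*} [Field k] {L : Finset (Fin 3 → ℤ)} {α : Fin 3 → ℤ}

lemma koszulMatrix_mulVec (a : koszulIndexOne L α → k) (q : koszulIndexTwo L α) :
    (koszulMatrix k L α).mulVec a q = extendZero _ a (q.1.1 + 1, q.1.2)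
      - extendZero _ a (q.1.1 + 1, q.1.2 + latticeUnit (q.1.1 + 2))
      - extendZero _ a (q.1.1 + 2, q.1.2)
      + extendZero _ a (q.1.1 + 2, q.1.2 + latticeUnit (q.1.1 + 1)) := by
  simp only [Matrix.mulVec, dotProduct, koszulMatrix, add_mul, sub_mul, Finset.sum_add_distrib,
    Finset.sum_sub_distrib, sum_kronecker_mul]

/-- The kernel of the middle Koszul differential consists of the closed systems. -/
lemma koszulMatrix_mulVec_eq_zero_iff (a : koszulIndexOne L α → k) :
    (koszulMatrix k L α).mulVec a = 0 ↔ ∀ j l : Fin 3, j ≠ l → ∀ v ∈ L,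
      v + α + latticeUnit j + latticeUnit l ∈ L →
      extendZero _ a (j, v) - extendZero _ a (j, v + latticeUnit l)
        = extendZero _ a (l, v) - extendZero _ a (l, v + latticeUnit j) := by
  have hc : ∀ (i : Fin 3) (v : Fin 3 → ℤ), v + α + 1 - latticeUnit i
      = v + α + latticeUnit (i + 1) + latticeUnit (i + 2) := fun i v => by
    rw [← latticeUnit_cyclic i]; abel
  constructor
  · intro h
    have key : ∀ i : Fin 3, ∀ v ∈ L, v + α + latticeUnit (i + 1) + latticeUnit (i + 2) ∈ L →
        extendZero _ a (i + 1, v) - extendZero _ a (i + 1, v + latticeUnit (i + 2))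
        = extendZero _ a (i + 2, v) - extendZero _ a (i + 2, v + latticeUnit (i + 1)) := by
      intro i v hv hv'
      have := congrFun h ⟨(i, v), mem_koszulIndexTwo.mpr ⟨hv, (hc i v).symm ▸ hv'⟩⟩
      rw [koszulMatrix_mulVec, Pi.zero_apply] at this
      linear_combination this
    intro j l hjl v hv hv'
    have hcases : (∃ i : Fin 3, j = i + 1 ∧ l = i + 2) ∨ (∃ i : Fin 3, j = i + 2 ∧ l = i + 1) := by
      clear hv' hv; revert hjl; revert j l; decide
    rcases hcases with ⟨i, rfl, rfl⟩ | ⟨i, rfl, rfl⟩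
    · exact key i v hv hv'
    · refine (key i v hv ?_).symm
      rwa [add_right_comm]
  · intro h
    funext q
    obtain ⟨⟨i, v⟩, hq⟩ := q
    rw [koszulMatrix_mulVec, Pi.zero_apply]
    rw [mem_koszulIndexTwo] at hq
    have hne : ∀ i : Fin 3, i + 1 ≠ i + 2 := by decide
    have := h (i + 1) (i + 2) (hne i) v hq.1 (by rw [← hc]; exact hq.2)
    linear_combination this

/-- The differential of the Koszul complex, on pairs of a homomorphism and an endomorphism. -/
def koszulDifferential (k : Type*) [Field k] (L : Finset (Fin 3 → ℤ)) (α : Fin 3 → ℤ) :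
    (homSpace k L α × (overlap L α → k)) →ₗ[k] (koszulIndexOne L α → k) :=
  let total : (homSpace k L α × (overlap L α → k)) →ₗ[k] ((Fin 3 → ℤ) → k) :=
    (homSpace k L α).subtype.coprod (extendZero _)
  LinearMap.pi fun p => (LinearMap.proj p.1.2).comp total
    - (LinearMap.proj (p.1.2 + latticeUnit p.1.1)).comp total

lemma koszulDifferential_apply (x : homSpace k L α × (overlap L α → k))
    (p : koszulIndexOne L α) : koszulDifferential k L α x p
      = (x.1.1 + extendZero _ x.2) p.1.2 - (x.1.1 + extendZero _ x.2) (p.1.2 + latticeUnit p.1.1) :=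
  rfl

lemma add_extendZero_support (hL : IsStaircase L) (x : homSpace k L α × (overlap L α → k)) :
    ∀ v, (x.1.1 + extendZero _ x.2) v ≠ 0 → 0 ≤ v ∧ v + α ∈ L := by
  intro v hv
  by_cases h : x.1.1 v = 0
  · rw [Pi.add_apply, h, zero_add] at hv
    have := mem_of_extendZero_ne_zero hv
    rw [overlap, Finset.mem_filter] at this
    exact ⟨hL.nonneg _ this.1, this.2⟩
  · exact ⟨(x.1.2.1 v h).1, (x.1.2.1 v h).2.2⟩

/-- The differential is recorded only at v ∈ L. Off L the zero extension is still correct, because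
the relations defining `homSpace` say exactly that the differences vanish there. -/
lemma extendZero_koszulDifferential (hL : IsStaircase L)
    (x : homSpace k L α × (overlap L α → k)) (j : Fin 3) {v : Fin 3 → ℤ} (hv : 0 ≤ v)
    (hv' : v + α + latticeUnit j ∈ L) : extendZero _ (koszulDifferential k L α x) (j, v)
      = (x.1.1 + extendZero _ x.2) v - (x.1.1 + extendZero _ x.2) (v + latticeUnit j) := by
  by_cases hvL : v ∈ L
  · rw [extendZero_mem _ (mem_koszulIndexOne.mpr ⟨hvL, hv'⟩), koszulDifferential_apply]
  · rw [extendZero_notMem _ (fun h => hvL (mem_koszulIndexOne.mp h).1)]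
    have z : ∀ w, w ∉ L → extendZero (overlap L α) x.2 w = 0 := fun w hw =>
      extendZero_notMem _ fun h => hw (Finset.mem_filter.mp h).1
    rw [Pi.add_apply, Pi.add_apply, z v hvL, z _ (hL.notMem_add hv hvL j),
      x.1.2.2 v j hv hvL hv']
    simp

/-- If all differences vanish, the glued function is invariant along e_i, hence zero by descent; its
restrictions off and on L are the two components. -/
lemma koszulDifferential_injective (hL : IsStaircase L) {i : Fin 3} (hα : α i < 0) :
    Function.Injective (koszulDifferential k L α) := by
  rw [injective_iff_map_eq_zero]
  intro x hx
  have h0 := hL.eq_zero_of_shift_invariant hα (add_extendZero_support hL x) (by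
    intro v hv hv'
    have := extendZero_koszulDifferential hL x i hv hv'
    rw [hx, map_zero, Pi.zero_apply] at this
    exact (sub_eq_zero.mp this.symm))
  have z : ∀ v, v ∉ L → extendZero (overlap L α) x.2 v = 0 := fun w hw =>
    extendZero_notMem _ fun h => hw (Finset.mem_filter.mp h).1
  have z' : ∀ v ∈ L, x.1.1 v = 0 := fun v hv => by
    by_contra hne; exact (x.1.2.1 v hne).2.1 hv
  refine Prod.ext (Subtype.ext (funext fun v => ?_)) (funext fun v => ?_)
  · by_cases hv : v ∈ L
    · exact z' v hv
    · have := congrFun h0 v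
      rwa [Pi.add_apply, z v hv, add_zero] at this
  · have := congrFun h0 v.1
    rwa [Pi.add_apply, z' _ (Finset.mem_filter.mp v.2).1, zero_add, extendZero_mem _ v.2] at this

/-- Differences in two directions commute, which gives closedness. Conversely, a closed system has a
primitive on ℕ³; its part off L is a homomorphism and its part on L an element of K⁰. -/
lemma range_koszulDifferential (hL : IsStaircase L) {i : Fin 3} (hα : α i < 0) :
    LinearMap.range (koszulDifferential k L α)
      = LinearMap.ker (koszulMatrix k L α).mulVecLin := by
  apply le_antisymm
  · rintro _ ⟨x, rfl⟩
    rw [LinearMap.mem_ker, Matrix.mulVecLin_apply, koszulMatrix_mulVec_eq_zero_iff]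
    intro j l hjl v hv hv'
    have hv0 := hL.nonneg v hv
    have hsupp := add_extendZero_support hL x
    set h := x.1.1 + extendZero _ x.2 with hh
    -- The entry (j, v) may be missing from the index set even though the closedness condition at v
    -- involves it. Then v + α has a negative l-th coordinate, so h vanishes at v and at v + e_j.
    have main : ∀ j l : Fin 3, j ≠ l → v + α + latticeUnit j + latticeUnit l ∈ L →
        extendZero _ (koszulDifferential k L α x) (j, v) = h v - h (v + latticeUnit j) := by
      intro j l hjl hv'
      by_cases hc : v + α + latticeUnit j ∈ L
      · exact extendZero_koszulDifferential hL x j hv0 hc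
      · rw [extendZero_notMem _ (fun h => hc (mem_koszulIndexOne.mp h).2)]
        have hneg := hL.neg_of_add_mem hv' hc
        simp only [Pi.add_apply, latticeUnit_of_ne (Ne.symm hjl)] at hneg
        have e1 : h v = 0 := by
          by_contra hne
          have := hL.coord_nonneg (hsupp v hne).2 l
          simp only [Pi.add_apply] at this
          omega
        have e2 : h (v + latticeUnit j) = 0 := by
          by_contra hne
          have := hL.coord_nonneg (hsupp _ hne).2 l
          simp only [Pi.add_apply, latticeUnit_of_ne (Ne.symm hjl)] at this
          omega
        rw [e1, e2, sub_zero]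
    have hv'' : v + α + latticeUnit l + latticeUnit j ∈ L := by rwa [add_right_comm]
    rw [main j l hjl hv', main l j hjl.symm hv'',
      extendZero_koszulDifferential hL x j (add_latticeUnit_nonneg hv0 l)
        (by convert hv' using 1; abel),
      extendZero_koszulDifferential hL x l (add_latticeUnit_nonneg hv0 j)
        (by convert hv' using 1; abel), ← hh, add_right_comm v]
    abel
  · intro a ha
    rw [LinearMap.mem_ker, Matrix.mulVecLin_apply, koszulMatrix_mulVec_eq_zero_iff] at ha
    obtain ⟨h, hsupp, hdiff⟩ := hL.exists_primitive hα (fun j v => extendZero _ a (j, v))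
      (fun j v hv => mem_koszulIndexOne.mp (mem_of_extendZero_ne_zero hv)) ha
    classical
    let c : homSpace k L α := ⟨fun v => if v ∈ L then 0 else h v, by
      refine ⟨fun u hu => ?_, fun u j h0 hu hu' => ?_⟩
      · by_cases hc : u ∈ L
        · simp [hc] at hu
        · simp only [hc, if_false] at hu
          exact ⟨(hsupp u hu).1, hc, (hsupp u hu).2⟩
      · simp only [hu, hL.notMem_add h0 hu j, if_false]
        have := hdiff j u h0 hu'
        rw [extendZero_notMem _ (fun h => hu (mem_koszulIndexOne.mp h).1)] at this
        exact sub_eq_zero.mp this⟩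
    have htot : c.1 + extendZero (overlap L α) (fun v => h v.1) = h := by
      funext v
      by_cases hv : v ∈ L
      · by_cases hv' : v + α ∈ L
        · have : v ∈ overlap L α := Finset.mem_filter.mpr ⟨hv, hv'⟩
          simp [c, hv, extendZero_mem _ this]
        · have : v ∉ overlap L α := fun h => hv' (Finset.mem_filter.mp h).2
          have h0 : h v = 0 := by
            by_contra hne; exact hv' (hsupp v hne).2
          simp [c, hv, extendZero_notMem _ this, h0]
      · have : v ∉ overlap L α := fun h => hv (Finset.mem_filter.mp h).1
        simp [c, hv, extendZero_notMem _ this]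
    refine ⟨(c, fun v => h v.1), ?_⟩
    funext p
    obtain ⟨⟨j, v⟩, hp⟩ := p
    have hp' := mem_koszulIndexOne.mp hp
    rw [koszulDifferential_apply, htot, hdiff j v (hL.nonneg _ hp'.1) hp'.2, extendZero_mem _ hp]

/-- The dimension of the graded component in terms of the rank of the Koszul differential. -/
lemma finrank_homSpace_add (hL : IsStaircase L) {i : Fin 3} (hα : α i < 0) :
    Module.finrank k (homSpace k L α) + (overlap L α).card + (koszulMatrix k L α).rank
      = ∑ j, (overlap L (α + latticeUnit j)).card := by
  have h1 := LinearMap.finrank_range_add_finrank_ker (koszulMatrix k L α).mulVecLin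
  have h2 := LinearMap.finrank_range_of_inj (koszulDifferential_injective (k := k) hL hα)
  rw [range_koszulDifferential hL hα, Module.finrank_prod, Module.finrank_fintype_fun_eq_card,
    Fintype.card_coe] at h2
  rw [Module.finrank_fintype_fun_eq_card, Fintype.card_coe, card_koszulIndexOne, h2] at h1
  rw [Matrix.rank]
  omega

/-- The difference of the dimensions of the graded components in complementary degrees is minus
the Euler characteristic of the Koszul complex. -/
lemma finrank_homSpace_sub (hL : IsStaircase L) {α' : Fin 3 → ℤ} (h : α + α' + 1 = 0)
    {i j : Fin 3} (hi : α i < 0) (hj : α' j < 0) :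
    (Module.finrank k (homSpace k L α) : ℤ) - Module.finrank k (homSpace k L α')
      = -(overlap L α).card + ∑ l, ((overlap L (α + latticeUnit l)).card : ℤ)
        - ∑ l, ((overlap L (α + 1 - latticeUnit l)).card : ℤ) + (overlap L (α + 1)).card := by
  have h1 := finrank_homSpace_add (k := k) hL hi
  have h2 := finrank_homSpace_add (k := k) hL hj
  rw [rank_koszulMatrix_eq k L h] at h2
  -- Swapping pairs turns the terms K⁰ and K¹ in degree α' into K³ and K² in degree α.
  have h3 : (overlap L α').card = (overlap L (α + 1)).card :=
    card_overlap_neg L (by linear_combination h)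
  have h4 : ∀ l, (overlap L (α' + latticeUnit l)).card = (overlap L (α + 1 - latticeUnit l)).card :=
    fun l => card_overlap_neg L (by linear_combination h)
  rw [h3] at h2
  simp only [h4] at h2
  zify at h1 h2
  linear_combination h1 - h2

end Koszul

/-! ### Signatures and the summed Euler characteristic. -/

/-- The opposite letter. -/
def SignLetter.flip : SignLetter → SignLetter
  | SignLetter.p => SignLetter.n
  | SignLetter.n => SignLetter.p

/-- The letter as a sign. -/
def SignLetter.sign : SignLetter → ℤ
  | SignLetter.p => 1
  | SignLetter.n => -1

/-- The indicator function of the condition given by a letter. -/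
def SignLetter.indicator : SignLetter → ℤ → ℤ
  | SignLetter.p, a => if 0 ≤ a then 1 else 0
  | SignLetter.n, a => if a < 0 then 1 else 0

lemma SignLetter.indicator_eq_ite (l : SignLetter) (a : ℤ) [Decidable (l.Admits a)] :
    l.indicator a = if l.Admits a then 1 else 0 := by
  cases l
  · by_cases h : 0 ≤ a <;> simp [SignLetter.indicator, SignLetter.Admits, h]
  · by_cases h : a < 0 <;> simp [SignLetter.indicator, SignLetter.Admits, h]

lemma SignLetter.indicator_flip (l : SignLetter) {a b : ℤ} (h : a + b + 1 = 0) :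
    l.flip.indicator b = l.indicator a := by
  cases l <;> simp only [SignLetter.flip, SignLetter.indicator] <;> split_ifs <;>
    first | rfl | omega

lemma SignLetter.indicator_sub (l : SignLetter) (a : ℤ) :
    l.indicator a - l.indicator (a - 1) = l.sign * if a = 0 then 1 else 0 := by
  cases l <;> simp only [SignLetter.sign, SignLetter.indicator] <;> split_ifs <;>
    first | rfl | omega

/-- The indicator function of the degrees with a given signature. -/
def signatureIndicator {n : ℕ} (s : Fin n → SignLetter) (α : Fin n → ℤ) : ℤ :=
  ∏ i, (s i).indicator (α i)

lemma signatureIndicator_eq_ite {n : ℕ} (s : Fin n → SignLetter) (α : Fin n → ℤ)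
    [Decidable (α ∈ signatureDegrees s)] :
    signatureIndicator s α = if α ∈ signatureDegrees s then 1 else 0 := by
  classical
  simp only [signatureIndicator, SignLetter.indicator_eq_ite]
  rw [Finset.prod_ite_zero]
  simp only [signatureDegrees, Set.mem_ofPred_eq, Finset.mem_univ, true_implies,
    Finset.prod_const_one]
  congr

lemma signatureIndicator_flip {n : ℕ} (s : Fin n → SignLetter) {α β : Fin n → ℤ}
    (h : α + β + 1 = 0) :
    signatureIndicator (fun i => (s i).flip) β = signatureIndicator s α :=
  Finset.prod_congr rfl fun i _ => (s i).indicator_flip (congrFun h i)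

/-- The alternating sum over subsets of {1,2,3} factors as minus the product over coordinates of the
indicator at δ_i minus the indicator at δ_i - 1. Each factor is a signed delta function at 0. -/
lemma signatureIndicator_euler (s : Fin 3 → SignLetter) (δ : Fin 3 → ℤ) :
    -signatureIndicator s δ + ∑ l, signatureIndicator s (δ - latticeUnit l)
      - ∑ l, signatureIndicator s (δ - 1 + latticeUnit l) + signatureIndicator s (δ - 1)
      = -(∏ i, (s i).sign) * if δ = 0 then 1 else 0 := by
  have hδ : (if δ = 0 then (1 : ℤ) else 0) = ∏ i, if δ i = 0 then (1 : ℤ) else 0 := by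
    rw [Finset.prod_ite_zero]
    simp [funext_iff]
  rw [hδ, neg_mul, ← Finset.prod_mul_distrib]
  simp only [← SignLetter.indicator_sub]
  simp only [signatureIndicator, Fin.prod_univ_three, Fin.sum_univ_three, latticeUnit]
  simp
  ring

lemma card_overlap_eq_sum {n : ℕ} (L : Finset (Fin n → ℤ)) (β : Fin n → ℤ) :
    ((overlap L β).card : ℤ) = ∑ u ∈ L, ∑ w ∈ L, if w - u = β then 1 else 0 := by
  rw [overlap, Finset.card_filter, Nat.cast_sum]
  refine Finset.sum_congr rfl fun u _ => ?_
  have : ∀ w : Fin n → ℤ, (w - u = β) ↔ (u + β = w) := fun w => by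
    rw [sub_eq_iff_eq_add', eq_comm]
  simp only [this, Finset.sum_ite_eq]
  split_ifs <;> rfl

/-- Double counting: each pair (u, w) belongs to the single degree w - u - σ, which B is assumed to
contain. -/
lemma sum_signatureIndicator_mul_card_overlap {n : ℕ} {L B : Finset (Fin n → ℤ)}
    (s : Fin n → SignLetter) (σ : Fin n → ℤ) (hB : ∀ u ∈ L, ∀ w ∈ L, w - u - σ ∈ B) :
    ∑ α ∈ B, signatureIndicator s α * ((overlap L (α + σ)).card : ℤ)
      = ∑ u ∈ L, ∑ w ∈ L, signatureIndicator s (w - u - σ) := by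
  simp only [card_overlap_eq_sum, Finset.mul_sum]
  rw [Finset.sum_comm]
  refine Finset.sum_congr rfl fun u hu => ?_
  rw [Finset.sum_comm]
  refine Finset.sum_congr rfl fun w hw => ?_
  rw [Finset.sum_eq_single (w - u - σ)]
  · simp
  · intro α _ hα
    have : w - u ≠ α + σ := fun h => hα (by rw [h]; abel)
    simp [this]
  · exact fun h => absurd (hB u hu w hw) h

/-- The box of all degrees with coordinates between `-N` and `N - 1`. -/
noncomputable def degreeBox (n : ℕ) (N : ℕ) : Finset (Fin n → ℤ) :=
  Fintype.piFinset fun _ => Finset.Ico (-(N : ℤ)) N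

lemma exists_subset_degreeBox {n : ℕ} (F : Finset (Fin n → ℤ)) : ∃ N, F ⊆ degreeBox n N := by
  refine ⟨∑ v ∈ F, ∑ i, ((v i).natAbs + 1), fun v hv => ?_⟩
  rw [degreeBox, Fintype.mem_piFinset]
  intro i
  have h1 : (v i).natAbs + 1 ≤ ∑ i, ((v i).natAbs + 1) :=
    Finset.single_le_sum (f := fun i => (v i).natAbs + 1) (fun _ _ => Nat.zero_le _)
      (Finset.mem_univ i)
  have h2 : ∑ i, ((v i).natAbs + 1) ≤ ∑ v ∈ F, ∑ i, ((v i).natAbs + 1) :=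
    Finset.single_le_sum (f := fun v : Fin n → ℤ => ∑ i, ((v i).natAbs + 1))
      (fun _ _ => Nat.zero_le _) hv
  rw [Finset.mem_Ico]
  omega

lemma sum_degreeBox_flip {n : ℕ} (N : ℕ) (f : (Fin n → ℤ) → ℤ) :
    ∑ α ∈ degreeBox n N, f α = ∑ α ∈ degreeBox n N, f (-1 - α) := by
  have hmem : ∀ α ∈ degreeBox n N, -1 - α ∈ degreeBox n N := by
    intro α hα
    simp only [degreeBox, Fintype.mem_piFinset, Finset.mem_Ico, Pi.sub_apply, Pi.neg_apply,
      Pi.one_apply] at hα ⊢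
    intro i
    have := hα i
    omega
  refine Finset.sum_bij' (fun α _ => -1 - α) (fun α _ => -1 - α) hmem hmem ?_ ?_ ?_
  · intro α _; abel
  · intro α _; abel
  · intro α _; congr 1; abel

/-- The comparison of the total dimensions for opposite signatures that are not constant. -/
lemma exists_sum_finrank_homSpace (k : Type*) [Field k] {L : Finset (Fin 3 → ℤ)}
    (hL : IsStaircase L) (F : Finset (Fin 3 → ℤ)) : ∃ B, F ⊆ B ∧ ∀ s : Fin 3 → SignLetter,
      ∀ i j, s i = SignLetter.n → s j = SignLetter.p →
      ∑ α ∈ B, signatureIndicator s α * (Module.finrank k (homSpace k L α) : ℤ)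
        = ∑ α ∈ B, signatureIndicator (fun i => (s i).flip) α
            * (Module.finrank k (homSpace k L α) : ℤ) - (∏ i, (s i).sign) * L.card := by
  classical
  -- The eight vectors e_A. The box must contain all degrees w - u - e_A for the double counting to
  -- be exact.
  let shifts : Finset (Fin 3 → ℤ) := {0, 1} ∪ Finset.univ.image latticeUnit
    ∪ Finset.univ.image fun l => 1 - latticeUnit l
  obtain ⟨N, hN⟩ := exists_subset_degreeBox
    (F ∪ ((L ×ˢ L) ×ˢ shifts).image fun p => p.1.2 - p.1.1 - p.2)
  refine ⟨degreeBox 3 N, Finset.union_subset_left hN, fun s i j hi hj => ?_⟩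
  have hB : ∀ σ ∈ shifts, ∀ u ∈ L, ∀ w ∈ L, w - u - σ ∈ degreeBox 3 N := by
    intro σ hσ u hu w hw
    refine Finset.union_subset_right hN (Finset.mem_image.mpr ⟨((u, w), σ), ?_, rfl⟩)
    simp [hu, hw, hσ]
  rw [sum_degreeBox_flip N fun α => signatureIndicator (fun i => (s i).flip) α
            * (Module.finrank k (homSpace k L α) : ℤ)]
  have hflip : ∀ α : Fin 3 → ℤ, signatureIndicator (fun i => (s i).flip) (-1 - α)
      = signatureIndicator s α := fun α => signatureIndicator_flip s (by abel)
  simp only [hflip]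
  rw [eq_sub_iff_add_eq, ← eq_sub_iff_add_eq', eq_comm, ← Finset.sum_sub_distrib]
  -- Since s contains both letters, α and -1 - α both have a negative coordinate whenever α has
  -- signature s, as the duality formula requires. In other degrees everything is multiplied by 0.
  have hterm : ∀ α, signatureIndicator s α * (Module.finrank k (homSpace k L (-1 - α)) : ℤ)
      - signatureIndicator s α * (Module.finrank k (homSpace k L α) : ℤ)
      = -(-(signatureIndicator s α * ((overlap L (α + 0)).card : ℤ))
        + ∑ l, signatureIndicator s α * ((overlap L (α + latticeUnit l)).card : ℤ)
        - ∑ l, signatureIndicator s α * ((overlap L (α + (1 - latticeUnit l))).card : ℤ)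
        + signatureIndicator s α * ((overlap L (α + 1)).card : ℤ)) := by
    intro α
    by_cases hα : α ∈ signatureDegrees s
    · have hi' : α i < 0 := by simpa [hi, SignLetter.Admits] using hα i
      have hj' : 0 ≤ α j := by simpa [hj, SignLetter.Admits] using hα j
      have := finrank_homSpace_sub (k := k) hL (α := α) (α' := -1 - α) (by abel) hi'
        (j := j) (by simp only [Pi.sub_apply, Pi.neg_apply, Pi.one_apply]; omega)
      simp only [← Finset.mul_sum, ← add_sub_assoc, add_zero]
      linear_combination (-signatureIndicator s α) * this
    · have h0 : signatureIndicator s α = 0 := by rw [signatureIndicator_eq_ite, if_neg hα]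
      simp [h0]
  have hpair : ∀ u w : Fin 3 → ℤ, -(-signatureIndicator s (w - u - 0)
      + ∑ l, signatureIndicator s (w - u - latticeUnit l)
      - ∑ l, signatureIndicator s (w - u - (1 - latticeUnit l))
      + signatureIndicator s (w - u - 1))
      = (∏ i, (s i).sign) * if w = u then 1 else 0 := by
    intro u w
    have := signatureIndicator_euler s (w - u)
    simp only [sub_zero, ← sub_add, sub_eq_zero] at this ⊢
    linear_combination -this
  have hcount := fun (σ : Fin 3 → ℤ) (hσ : σ ∈ shifts) =>
    sum_signatureIndicator_mul_card_overlap s σ (hB σ hσ)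
  calc _ = -(-(∑ u ∈ L, ∑ w ∈ L, signatureIndicator s (w - u - 0))
        + ∑ l, ∑ u ∈ L, ∑ w ∈ L, signatureIndicator s (w - u - latticeUnit l)
        - ∑ l, ∑ u ∈ L, ∑ w ∈ L, signatureIndicator s (w - u - (1 - latticeUnit l))
        + ∑ u ∈ L, ∑ w ∈ L, signatureIndicator s (w - u - 1)) := by
        simp only [Finset.sum_congr rfl fun α _ => hterm α, Finset.sum_neg_distrib,
          Finset.sum_add_distrib, Finset.sum_sub_distrib, Fin.sum_univ_three]
        rw [hcount 0 (by simp [shifts]), hcount 1 (by simp [shifts])]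
        simp only [hcount (latticeUnit _) (by simp [shifts]),
          hcount (1 - latticeUnit _) (by simp [shifts])]
    _ = ∑ u ∈ L, ∑ w ∈ L, (∏ i, (s i).sign) * if w = u then 1 else 0 := by
        simp only [← hpair, Finset.sum_neg_distrib, Finset.sum_add_distrib,
          Finset.sum_sub_distrib, Fin.sum_univ_three]
    _ = _ := by
        simp only [← Finset.mul_sum, Finset.sum_ite_eq']
        simp

/-! ### Dictionary between monomials, the quotient and the staircase. -/

section Exponents

variable {n : ℕ}

/-- The exponent vector with the given coordinates, negative ones being replaced by zero. -/
noncomputable def toExponent (v : Fin n → ℤ) : Fin n →₀ ℕ :=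
  Finsupp.equivFunOnFinite.symm fun i => (v i).toNat

/-- An exponent vector as a degree. -/
def exponentDegree (u : Fin n →₀ ℕ) : Fin n → ℤ := fun i => (u i : ℤ)

lemma toExponent_apply (v : Fin n → ℤ) (i : Fin n) : toExponent v i = (v i).toNat := rfl

lemma toExponent_exponentDegree (u : Fin n →₀ ℕ) : toExponent (exponentDegree u) = u := by
  ext i
  simp [toExponent_apply, exponentDegree]

lemma exponentDegree_toExponent {v : Fin n → ℤ} (hv : 0 ≤ v) :
    exponentDegree (toExponent v) = v := by
  funext i
  simpa [toExponent_apply, exponentDegree] using hv i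

lemma exponentDegree_nonneg (u : Fin n →₀ ℕ) : 0 ≤ exponentDegree u := fun i => by
  simp [exponentDegree]

lemma toExponent_add_latticeUnit {v : Fin n → ℤ} (hv : 0 ≤ v) (i : Fin n) :
    toExponent (v + latticeUnit i) = toExponent v + Finsupp.single i 1 := by
  ext j
  have := hv j
  simp only [Pi.zero_apply] at this
  by_cases h : j = i
  · subst h
    simp only [toExponent_apply, Pi.add_apply, latticeUnit_self, Finsupp.add_apply,
      Finsupp.single_eq_same]
    omega
  · simp [toExponent_apply, latticeUnit_of_ne h, h]

end Exponents

section Monomial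

variable {k : Type*} [Field k] {n : ℕ} {I : Ideal (MvPolynomial (Fin n) k)}

lemma IsMonomialIdeal.mem_iff (hI : IsMonomialIdeal I) {f : MvPolynomial (Fin n) k} :
    f ∈ I ↔ ∀ u ∈ f.support, monomial u (1 : k) ∈ I := by
  obtain ⟨A, rfl⟩ := hI
  simp only [mem_ideal_span_monomial_image]
  constructor
  · intro h u hu v hv
    obtain rfl : v = u := by simpa using support_monomial_subset hv
    exact h v hu
  · intro h u hu
    exact h u hu u (by simp)

/-- A finite set is the staircase of an ideal if it consists of the exponents of the monomials
outside the ideal. -/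
def IsStaircaseOf (L : Finset (Fin n → ℤ)) (I : Ideal (MvPolynomial (Fin n) k)) : Prop :=
  ∀ v, v ∈ L ↔ 0 ≤ v ∧ monomial (toExponent v) (1 : k) ∉ I

/-- The class of a monomial in the quotient, zero in degrees with a negative coordinate. -/
noncomputable def quotientMonomial (I : Ideal (MvPolynomial (Fin n) k)) (v : Fin n → ℤ) :
    MvPolynomial (Fin n) k ⧸ I :=
  open Classical in if 0 ≤ v then Ideal.Quotient.mk I (monomial (toExponent v) 1) else 0

/-- The monomial of the given degree as an element of the ideal, zero if it is not in the ideal. -/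
noncomputable def idealMonomial (I : Ideal (MvPolynomial (Fin n) k)) (v : Fin n → ℤ) : I :=
  open Classical in if h : 0 ≤ v ∧ monomial (toExponent v) 1 ∈ I then ⟨_, h.2⟩ else 0

variable {L : Finset (Fin n → ℤ)}

lemma IsStaircaseOf.exponentDegree_mem (hLI : IsStaircaseOf L I) (u : Fin n →₀ ℕ) :
    exponentDegree u ∈ L ↔ monomial u (1 : k) ∉ I := by
  rw [hLI, toExponent_exponentDegree]
  simp [exponentDegree_nonneg]

lemma IsStaircaseOf.isStaircase (hLI : IsStaircaseOf L I) : IsStaircase L where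
  nonneg v hv := ((hLI v).mp hv).1
  mem_of_le v hv w hw hwv := by
    refine (hLI w).mpr ⟨hw, fun hmem => ((hLI v).mp hv).2 ?_⟩
    have hle : toExponent w ≤ toExponent v := fun i => Int.toNat_le_toNat (hwv i)
    rw [← tsub_add_cancel_of_le hle, ← one_mul (1 : k), ← monomial_mul]
    exact I.mul_mem_left _ hmem

lemma quotientMonomial_of_notMem (hLI : IsStaircaseOf L I) {v : Fin n → ℤ} (hv : v ∉ L) :
    quotientMonomial I v = 0 := by
  rw [quotientMonomial]
  split_ifs with h
  · rw [Ideal.Quotient.eq_zero_iff_mem]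
    by_contra hmem
    exact hv ((hLI v).mpr ⟨h, hmem⟩)
  · rfl

lemma smul_quotient_mk (p f : MvPolynomial (Fin n) k) :
    p • Ideal.Quotient.mk I f = Ideal.Quotient.mk I (p * f) := rfl

lemma X_smul_quotientMonomial {v : Fin n → ℤ} (hv : 0 ≤ v) (i : Fin n) :
    (X i : MvPolynomial (Fin n) k) • quotientMonomial I v
      = quotientMonomial I (v + latticeUnit i) := by
  rw [quotientMonomial, quotientMonomial, if_pos hv, if_pos (add_latticeUnit_nonneg hv i),
    toExponent_add_latticeUnit hv, smul_quotient_mk, X,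
    monomial_mul, one_mul, add_comm]

lemma idealMonomial_of_mem (hLI : IsStaircaseOf L I) {v : Fin n → ℤ} (hv : 0 ≤ v) (hvL : v ∉ L) :
    (idealMonomial I v : MvPolynomial (Fin n) k) = monomial (toExponent v) 1 := by
  have : 0 ≤ v ∧ monomial (toExponent v) (1 : k) ∈ I := by
    refine ⟨hv, ?_⟩
    by_contra h
    exact hvL ((hLI v).mpr ⟨hv, h⟩)
  rw [idealMonomial, dif_pos this]

lemma idealMonomial_eq_zero (hLI : IsStaircaseOf L I) {v : Fin n → ℤ} (h : ¬ (0 ≤ v ∧ v ∉ L)) :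
    idealMonomial I v = 0 := by
  rw [idealMonomial, dif_neg]
  rintro ⟨h1, h2⟩
  exact h ⟨h1, fun hv => ((hLI v).mp hv).2 h2⟩

lemma X_smul_idealMonomial (hLI : IsStaircaseOf L I) {v : Fin n → ℤ} (hv : 0 ≤ v) (hvL : v ∉ L)
    (i : Fin n) : (X i : MvPolynomial (Fin n) k) • idealMonomial I v
      = idealMonomial I (v + latticeUnit i) := by
  ext1
  rw [Submodule.coe_smul, idealMonomial_of_mem hLI hv hvL,
    idealMonomial_of_mem hLI (add_latticeUnit_nonneg hv i) (hLI.isStaircase.notMem_add hv hvL i),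
    toExponent_add_latticeUnit hv, smul_eq_mul, X, monomial_mul, one_mul, add_comm]

/-- An element of a monomial ideal is the combination of its monomials, taken in the ideal. -/
lemma eq_sum_idealMonomial (hI : IsMonomialIdeal I) (hLI : IsStaircaseOf L I) (f : I) :
    f = ∑ u ∈ (f : MvPolynomial (Fin n) k).support,
      coeff u (f : MvPolynomial (Fin n) k) • idealMonomial I (exponentDegree u) := by
  ext1
  have hmem := hI.mem_iff.mp f.2
  conv_lhs => rw [(f : MvPolynomial (Fin n) k).as_sum]
  rw [AddSubmonoidClass.coe_finsetSum]
  refine Finset.sum_congr rfl fun u hu => ?_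
  have hu' : exponentDegree u ∉ L := fun h => (hLI.exponentDegree_mem u).mp h (hmem u hu)
  rw [Submodule.coe_smul_of_tower, idealMonomial_of_mem hLI (exponentDegree_nonneg u) hu',
    toExponent_exponentDegree, smul_monomial, smul_eq_mul, mul_one]

/-- The coefficient of a monomial outside the ideal, as a functional on the quotient. -/
noncomputable def quotientCoeff (hI : IsMonomialIdeal I) (L : Finset (Fin n → ℤ))
    (hLI : IsStaircaseOf L I) (v : Fin n → ℤ) : (MvPolynomial (Fin n) k ⧸ I) →ₗ[k] k :=
  (I.restrictScalars k).liftQ (if v ∈ L then lcoeff k (toExponent v) else 0) (by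
    intro f hf
    rw [LinearMap.mem_ker]
    split_ifs with hv
    · by_contra hne
      exact ((hLI v).mp hv).2 (hI.mem_iff.mp hf _ (mem_support_iff.mpr hne))
    · rfl)

variable (hI : IsMonomialIdeal I) (hLI : IsStaircaseOf L I)

lemma quotientCoeff_mk (v : Fin n → ℤ) (f : MvPolynomial (Fin n) k) :
    quotientCoeff hI L hLI v (Ideal.Quotient.mk I f)
      = if v ∈ L then coeff (toExponent v) f else 0 := by
  have : quotientCoeff hI L hLI v (Ideal.Quotient.mk I f)
      = (if v ∈ L then lcoeff k (toExponent v) else 0 : MvPolynomial (Fin n) k →ₗ[k] k) f := rfl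
  rw [this]
  split_ifs <;> rfl

lemma quotientCoeff_of_notMem {v : Fin n → ℤ} (hv : v ∉ L) (x : MvPolynomial (Fin n) k ⧸ I) :
    quotientCoeff hI L hLI v x = 0 := by
  obtain ⟨f, rfl⟩ := Ideal.Quotient.mk_surjective x
  rw [quotientCoeff_mk, if_neg hv]

lemma quotientCoeff_quotientMonomial_self {v : Fin n → ℤ} (hv : v ∈ L) :
    quotientCoeff hI L hLI v (quotientMonomial I v) = 1 := by
  rw [quotientMonomial, if_pos (hLI.isStaircase.nonneg v hv), quotientCoeff_mk, if_pos hv,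
    coeff_monomial, if_pos rfl]

lemma quotientCoeff_quotientMonomial_of_ne {v w : Fin n → ℤ} (h : v ≠ w) :
    quotientCoeff hI L hLI v (quotientMonomial I w) = 0 := by
  by_cases hv : v ∈ L
  · rw [quotientMonomial]
    split_ifs with hw
    · rw [quotientCoeff_mk, if_pos hv, coeff_monomial, if_neg]
      intro e
      apply h
      rw [← exponentDegree_toExponent hw, e,
        exponentDegree_toExponent (hLI.isStaircase.nonneg v hv)]
    · rw [map_zero]
  · exact quotientCoeff_of_notMem hI hLI hv _

/-- Also valid for v outside L: then v_i = -1, the target monomial is not divisible by x_i, and both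
sides are 0. -/
lemma quotientCoeff_X_smul {v : Fin n → ℤ} {i : Fin n} (hv : v + latticeUnit i ∈ L)
    (x : MvPolynomial (Fin n) k ⧸ I) :
    quotientCoeff hI L hLI (v + latticeUnit i) ((X i : MvPolynomial (Fin n) k) • x)
      = quotientCoeff hI L hLI v x := by
  obtain ⟨f, rfl⟩ := Ideal.Quotient.mk_surjective x
  rw [smul_quotient_mk, quotientCoeff_mk,
    quotientCoeff_mk, if_pos hv]
  by_cases hvL : v ∈ L
  · rw [if_pos hvL, toExponent_add_latticeUnit (hLI.isStaircase.nonneg v hvL), add_comm,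
      coeff_X_mul]
  · have hneg := hLI.isStaircase.neg_of_add_mem hv hvL
    rw [if_neg hvL, coeff_X_mul', if_neg]
    rw [Finsupp.mem_support_iff, toExponent_apply, not_not, Int.toNat_eq_zero]
    simp only [Pi.add_apply, latticeUnit_self]
    omega

lemma quotient_eq_zero_of_quotientCoeff {x : MvPolynomial (Fin n) k ⧸ I}
    (h : ∀ v, quotientCoeff hI L hLI v x = 0) : x = 0 := by
  obtain ⟨f, rfl⟩ := Ideal.Quotient.mk_surjective x
  rw [Ideal.Quotient.eq_zero_iff_mem, hI.mem_iff]
  intro u hu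
  by_contra hmem
  have := h (exponentDegree u)
  rw [quotientCoeff_mk, if_pos ((hLI.exponentDegree_mem u).mpr hmem),
    toExponent_exponentDegree] at this
  exact mem_support_iff.mp hu this

/-- The quotient by a monomial ideal is the space of functions on its staircase. -/
lemma finrank_quotient (hI : IsMonomialIdeal I) (hLI : IsStaircaseOf L I) :
    Module.finrank k (MvPolynomial (Fin n) k ⧸ I) = L.card := by
  let F : (MvPolynomial (Fin n) k ⧸ I) →ₗ[k] (L → k) :=
    LinearMap.pi fun v => quotientCoeff hI L hLI v.1
  have hF : Function.Bijective F := by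
    constructor
    · rw [injective_iff_map_eq_zero]
      intro x hx
      refine quotient_eq_zero_of_quotientCoeff hI hLI fun v => ?_
      by_cases hv : v ∈ L
      · exact congrFun hx ⟨v, hv⟩
      · exact quotientCoeff_of_notMem hI hLI hv x
    · intro b
      refine ⟨∑ v : L, b v • quotientMonomial I v.1, ?_⟩
      funext w
      simp only [F, LinearMap.pi_apply, map_sum, map_smul, smul_eq_mul]
      rw [Finset.sum_eq_single w]
      · rw [quotientCoeff_quotientMonomial_self hI hLI w.2, mul_one]
      · intro v _ hv
        rw [quotientCoeff_quotientMonomial_of_ne hI hLI fun e => hv (Subtype.ext e.symm), mul_zero]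
      · simp
  rw [(LinearEquiv.ofBijective F hF).finrank_eq, Module.finrank_fintype_fun_eq_card,
    Fintype.card_coe]

/-- A monomial ideal of finite colength has a finite staircase. -/
lemma IsMonomialIdeal.exists_isStaircaseOf (hI : IsMonomialIdeal I)
    (hfin : Module.Finite k (MvPolynomial (Fin n) k ⧸ I)) : ∃ L, IsStaircaseOf L I := by
  -- Monomials outside I have independent classes, so finite dimension bounds their number.
  have hli : LinearIndependent k fun u : {u : Fin n →₀ ℕ // monomial u (1 : k) ∉ I} =>
      Ideal.Quotient.mk I (monomial u.1 1) := by
    rw [linearIndependent_iff']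
    intro s g hg u hu
    have hg' : Ideal.Quotient.mk I (∑ u ∈ s, g u • monomial u.1 (1 : k)) = 0 := by
      rw [map_sum, ← hg]
      refine Finset.sum_congr rfl fun v _ => ?_
      exact map_smul (Ideal.Quotient.mkₐ k I) (g v) _
    rw [Ideal.Quotient.eq_zero_iff_mem, hI.mem_iff] at hg'
    by_contra hne
    refine u.2 (hg' u.1 ?_)
    rw [mem_support_iff, coeff_sum, Finset.sum_eq_single u]
    · simpa using hne
    · intro v _ hv
      rw [coeff_smul, coeff_monomial, if_neg fun e => hv (Subtype.ext e), smul_zero]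
    · exact fun h => absurd hu h
  have : Finite {u : Fin n →₀ ℕ // monomial u (1 : k) ∉ I} := hli.finite
  have hf : {u : Fin n →₀ ℕ | monomial u (1 : k) ∉ I}.Finite := this
  refine ⟨(hf.image exponentDegree).toFinset, fun v => ?_⟩
  rw [Set.Finite.mem_toFinset]
  constructor
  · rintro ⟨u, hu, rfl⟩
    exact ⟨exponentDegree_nonneg u, by rwa [toExponent_exponentDegree]⟩
  · rintro ⟨h0, h1⟩
    exact ⟨toExponent v, h1, exponentDegree_toExponent h0⟩

end Monomial

/-! ### Decomposition of T(I) into graded components. -/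

section Tangent

variable {k : Type*} [Field k] {n : ℕ} {I : Ideal (MvPolynomial (Fin n) k)}
  {L : Finset (Fin n → ℤ)}

/-- The coefficients of the degree `α` part of a homomorphism. -/
noncomputable def tangentCoeff (hI : IsMonomialIdeal I) (hLI : IsStaircaseOf L I)
    (α : Fin n → ℤ) : TangentSpaceAt I →ₗ[k] homSpace k L α where
  toFun φ := ⟨fun u => quotientCoeff hI L hLI (u + α) (φ (idealMonomial I u)), by
    constructor
    · intro u hu
      have h1 : 0 ≤ u ∧ u ∉ L := by
        by_contra h
        exact hu (by simp only [idealMonomial_eq_zero hLI h, map_zero])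
      refine ⟨h1.1, h1.2, ?_⟩
      by_contra h
      exact hu (quotientCoeff_of_notMem hI hLI h _)
    · intro u i h0 hu hu'
      simp only [← X_smul_idealMonomial hLI h0 hu, map_smul, add_right_comm u (latticeUnit i),
        quotientCoeff_X_smul hI hLI hu']⟩
  map_add' φ ψ := by
    ext u
    simp
  map_smul' r φ := by
    ext u
    simp

/-- The linear map from the polynomial ring with the given coefficients. -/
noncomputable def tangentLift (I : Ideal (MvPolynomial (Fin n) k)) (α : Fin n → ℤ)
    (c : (Fin n → ℤ) → k) : MvPolynomial (Fin n) k →ₗ[k] MvPolynomial (Fin n) k ⧸ I :=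
  (basisMonomials (Fin n) k).constr k fun u =>
    c (exponentDegree u) • quotientMonomial I (exponentDegree u + α)

lemma tangentLift_monomial (α : Fin n → ℤ) (c : (Fin n → ℤ) → k) (u : Fin n →₀ ℕ) :
    tangentLift I α c (monomial u 1)
      = c (exponentDegree u) • quotientMonomial I (exponentDegree u + α) := by
  have := (basisMonomials (Fin n) k).constr_basis k (fun u =>
    c (exponentDegree u) • quotientMonomial I (exponentDegree u + α)) u
  rwa [coe_basisMonomials] at this

lemma tangentLift_idealMonomial (hLI : IsStaircaseOf L I) {α : Fin n → ℤ}
    (c : homSpace k L α) (u : Fin n → ℤ) :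
    tangentLift I α c.1 (idealMonomial I u) = c.1 u • quotientMonomial I (u + α) := by
  by_cases h : 0 ≤ u ∧ u ∉ L
  · rw [idealMonomial_of_mem hLI h.1 h.2, tangentLift_monomial, exponentDegree_toExponent h.1]
  · have : c.1 u = 0 := by
      by_contra hne
      exact h ⟨(c.2.1 u hne).1, (c.2.1 u hne).2.1⟩
    rw [idealMonomial_eq_zero hLI h, this, zero_smul]
    exact map_zero _

/-- The lift is only k-linear on S in general, since c vanishes on L but not beyond it;
compatibility with x_i holds on I and reduces to the relations of `homSpace` on monomials. -/
lemma tangentLift_X_mul (hI : IsMonomialIdeal I) (hLI : IsStaircaseOf L I) {α : Fin n → ℤ}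
    (c : homSpace k L α) (i : Fin n) (f : I) :
    tangentLift I α c.1 (X i * (f : MvPolynomial (Fin n) k))
      = (X i : MvPolynomial (Fin n) k) • tangentLift I α c.1 f := by
  have key : ∀ u, tangentLift I α c.1 (X i * (idealMonomial I u : MvPolynomial (Fin n) k))
      = (X i : MvPolynomial (Fin n) k) • tangentLift I α c.1 (idealMonomial I u) := by
    intro u
    by_cases h : 0 ≤ u ∧ u ∉ L
    · rw [← smul_eq_mul, ← Submodule.coe_smul, X_smul_idealMonomial hLI h.1 h.2,
        tangentLift_idealMonomial hLI, tangentLift_idealMonomial hLI, add_right_comm]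
      by_cases hL : u + α + latticeUnit i ∈ L
      · rw [← c.2.2 u i h.1 h.2 hL]
        by_cases hc : c.1 u = 0
        · simp [hc]
        · have h0 := hLI.isStaircase.nonneg _ (c.2.1 u hc).2.2
          rw [← X_smul_quotientMonomial h0, smul_comm]
      · rw [quotientMonomial_of_notMem hLI hL, smul_zero]
        by_cases hc : c.1 u = 0
        · simp [hc]
        · have h0 := hLI.isStaircase.nonneg _ (c.2.1 u hc).2.2
          rw [smul_comm, X_smul_quotientMonomial h0, quotientMonomial_of_notMem hLI hL, smul_zero]
    · rw [idealMonomial_eq_zero hLI h]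
      simp
  rw [eq_sum_idealMonomial hI hLI f]
  simp only [AddSubmonoidClass.coe_finsetSum, Submodule.coe_smul_of_tower, Finset.mul_sum,
    map_sum, Finset.smul_sum, mul_smul_comm, map_smul, key]
  exact Finset.sum_congr rfl fun u _ => smul_comm _ _ _

/-- The homomorphism with the given coefficients. -/
noncomputable def tangentOfCoeff (hI : IsMonomialIdeal I) (hLI : IsStaircaseOf L I)
    (α : Fin n → ℤ) : homSpace k L α →ₗ[k] TangentSpaceAt I where
  toFun c :=
    { toFun := fun f => tangentLift I α c.1 f
      map_add' := fun f g => by rw [Submodule.coe_add, map_add]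
      map_smul' := fun p f => by
        rw [RingHom.id_apply, Submodule.coe_smul, smul_eq_mul]
        induction p using MvPolynomial.induction_on generalizing f with
        | C a =>
          rw [← smul_eq_C_mul, map_smul, ← algebraMap_eq, algebraMap_smul]
        | add p q hp hq => rw [add_mul, map_add, hp, hq, add_smul]
        | mul_X p i hp =>
          have := hp ((X i : MvPolynomial (Fin n) k) • f)
          rw [Submodule.coe_smul, smul_eq_mul, ← mul_assoc, tangentLift_X_mul hI hLI] at this
          rw [this, mul_smul] }
  map_add' c c' := by
    ext1 f
    have : tangentLift I α (c + c').1 = tangentLift I α c.1 + tangentLift I α c'.1 := by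
      refine (basisMonomials (Fin n) k).ext fun u => ?_
      simp [tangentLift_monomial, add_smul]
    exact LinearMap.congr_fun this f.1
  map_smul' r c := by
    ext1 f
    have : tangentLift I α (r • c).1 = r • tangentLift I α c.1 := by
      refine (basisMonomials (Fin n) k).ext fun u => ?_
      simp [tangentLift_monomial, mul_smul]
    exact LinearMap.congr_fun this f.1

lemma tangentOfCoeff_idealMonomial (hI : IsMonomialIdeal I) (hLI : IsStaircaseOf L I)
    {α : Fin n → ℤ} (c : homSpace k L α) (u : Fin n → ℤ) :
    tangentOfCoeff hI hLI α c (idealMonomial I u) = c.1 u • quotientMonomial I (u + α) :=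
  tangentLift_idealMonomial hLI c u

lemma tangentCoeff_tangentOfCoeff_self (hI : IsMonomialIdeal I) (hLI : IsStaircaseOf L I)
    {α : Fin n → ℤ} (c : homSpace k L α) :
    tangentCoeff hI hLI α (tangentOfCoeff hI hLI α c) = c := by
  ext u
  change quotientCoeff hI L hLI (u + α) (tangentOfCoeff hI hLI α c (idealMonomial I u)) = c.1 u
  rw [tangentOfCoeff_idealMonomial, map_smul]
  by_cases hc : c.1 u = 0
  · simp [hc]
  · rw [quotientCoeff_quotientMonomial_self hI hLI (c.2.1 u hc).2.2, smul_eq_mul, mul_one]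

lemma tangentCoeff_tangentOfCoeff_of_ne (hI : IsMonomialIdeal I) (hLI : IsStaircaseOf L I)
    {α β : Fin n → ℤ} (h : β ≠ α) (c : homSpace k L α) :
    tangentCoeff hI hLI β (tangentOfCoeff hI hLI α c) = 0 := by
  ext u
  change quotientCoeff hI L hLI (u + β) (tangentOfCoeff hI hLI α c (idealMonomial I u)) = 0
  rw [tangentOfCoeff_idealMonomial, map_smul,
    quotientCoeff_quotientMonomial_of_ne hI hLI (fun e => h (add_left_cancel e)), smul_zero]

lemma tangent_ext (hI : IsMonomialIdeal I) (hLI : IsStaircaseOf L I) {φ ψ : TangentSpaceAt I}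
    (h : ∀ α, tangentCoeff hI hLI α φ = tangentCoeff hI hLI α ψ) : φ = ψ := by
  have key : ∀ u, φ (idealMonomial I u) = ψ (idealMonomial I u) := by
    intro u
    rw [← sub_eq_zero]
    refine quotient_eq_zero_of_quotientCoeff hI hLI fun v => ?_
    have := congrFun (congrArg Subtype.val (h (v - u))) u
    change quotientCoeff hI L hLI (u + (v - u)) _ = quotientCoeff hI L hLI (u + (v - u)) _ at this
    rw [add_sub_cancel] at this
    rw [map_sub, this, sub_self]
  ext1 f
  rw [eq_sum_idealMonomial hI hLI f]
  simp only [map_sum, LinearMap.map_smul_of_tower, key]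

lemma quotientMonomial_mem_quotientPiece (v : Fin n → ℤ) :
    quotientMonomial I v ∈ quotientPiece I v := by
  rw [quotientMonomial]
  split_ifs with h
  · exact Submodule.mem_map.mpr ⟨monomial (toExponent v) 1, Submodule.subset_span
      ⟨toExponent v, congrFun (exponentDegree_toExponent h), rfl⟩, rfl⟩
  · exact Submodule.zero_mem _

lemma exponentDegree_of_mem_support {β : Fin n → ℤ} {f : MvPolynomial (Fin n) k}
    (hf : f ∈ polyPiece k β) : ∀ u ∈ f.support, exponentDegree u = β := by
  rw [polyPiece] at hf
  induction hf using Submodule.span_induction with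
  | mem f hf =>
    obtain ⟨w, hw, rfl⟩ := hf
    intro u hu
    obtain rfl : u = w := by simpa using support_monomial_subset hu
    exact funext hw
  | zero => simp
  | add f g _ _ hf hg =>
    intro u hu
    rcases Finset.mem_union.mp (support_add hu) with h | h
    · exact hf u h
    · exact hg u h
  | smul r f _ hf => exact fun u hu => hf u (support_smul hu)

lemma quotientCoeff_of_mem_quotientPiece (hI : IsMonomialIdeal I) (hLI : IsStaircaseOf L I)
    {γ v : Fin n → ℤ} (h : v ≠ γ) {x : MvPolynomial (Fin n) k ⧸ I} (hx : x ∈ quotientPiece I γ) :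
    quotientCoeff hI L hLI v x = 0 := by
  obtain ⟨f, hf, rfl⟩ := Submodule.mem_map.mp hx
  change quotientCoeff hI L hLI v (Ideal.Quotient.mk I f) = 0
  rw [quotientCoeff_mk]
  split_ifs with hv
  · by_contra hne
    apply h
    rw [← exponentDegree_of_mem_support hf _ (mem_support_iff.mpr hne),
      exponentDegree_toExponent (hLI.isStaircase.nonneg v hv)]
  · rfl

lemma tangentOfCoeff_mem_tangentPiece (hI : IsMonomialIdeal I) (hLI : IsStaircaseOf L I)
    {α : Fin n → ℤ} (c : homSpace k L α) : tangentOfCoeff hI hLI α c ∈ tangentPiece I α := by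
  intro β f hf
  rw [eq_sum_idealMonomial hI hLI f]
  simp only [map_sum, LinearMap.map_smul_of_tower]
  refine Submodule.sum_mem _ fun u hu => Submodule.smul_mem _ _ ?_
  rw [tangentOfCoeff_idealMonomial, exponentDegree_of_mem_support hf u hu, add_comm β]
  exact Submodule.smul_mem _ _ (quotientMonomial_mem_quotientPiece _)

lemma tangentCoeff_of_mem_tangentPiece (hI : IsMonomialIdeal I) (hLI : IsStaircaseOf L I)
    {α β : Fin n → ℤ} (h : β ≠ α) {φ : TangentSpaceAt I} (hφ : φ ∈ tangentPiece I α) :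
    tangentCoeff hI hLI β φ = 0 := by
  ext u
  change quotientCoeff hI L hLI (u + β) (φ (idealMonomial I u)) = 0
  by_cases hu : 0 ≤ u ∧ u ∉ L
  · have hmem : (idealMonomial I u : MvPolynomial (Fin n) k) ∈ polyPiece k u := by
      rw [idealMonomial_of_mem hLI hu.1 hu.2]
      exact Submodule.subset_span
        ⟨toExponent u, congrFun (exponentDegree_toExponent hu.1), rfl⟩
    refine quotientCoeff_of_mem_quotientPiece hI hLI (γ := α + u) ?_ (hφ u _ hmem)
    rw [add_comm α u]
    exact fun e => h (add_left_cancel e)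
  · rw [idealMonomial_eq_zero hLI hu, map_zero, map_zero]

/-- The space of homomorphisms is finite-dimensional. -/
lemma finite_tangentSpace (hfin : Module.Finite k (MvPolynomial (Fin n) k ⧸ I)) :
    Module.Finite k (TangentSpaceAt I) := by
  obtain ⟨s, hs⟩ := (inferInstance : Module.Finite (MvPolynomial (Fin n) k) I).fg_top
  let F : TangentSpaceAt I →ₗ[k] (s → MvPolynomial (Fin n) k ⧸ I) :=
    { toFun := fun φ f => φ f.1
      map_add' := fun _ _ => rfl
      map_smul' := fun _ _ => rfl }
  refine Module.Finite.of_injective F fun φ ψ h => ?_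
  exact LinearMap.ext_on hs fun f hf => congrFun h ⟨f, hf⟩

/-- Only finitely many graded components of the space of homomorphisms are nonzero. -/
lemma exists_finset_homSpace_eq_bot (hI : IsMonomialIdeal I) (hLI : IsStaircaseOf L I)
    (hfin : Module.Finite k (MvPolynomial (Fin n) k ⧸ I)) :
    ∃ F : Finset (Fin n → ℤ), ∀ α ∉ F, homSpace k L α = ⊥ := by
  have := finite_tangentSpace hfin
  -- An independent family of subspaces of a finite-dimensional space has only finitely many nonzero
  -- members.
  have hind : iSupIndep fun α => tangentPiece I α := by
    rw [iSupIndep_def]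
    intro α
    rw [Submodule.disjoint_def]
    intro φ hφ hφ'
    refine tangent_ext hI hLI fun β => ?_
    rw [map_zero]
    by_cases hβ : β = α
    · subst hβ
      have hle : ⨆ γ, ⨆ (_ : γ ≠ β), tangentPiece I γ
          ≤ LinearMap.ker (tangentCoeff hI hLI β) :=
        iSup₂_le fun γ hγ ψ hψ => tangentCoeff_of_mem_tangentPiece hI hLI hγ.symm hψ
      exact hle hφ'
    · exact tangentCoeff_of_mem_tangentPiece hI hLI hβ hφ
  have hF := WellFoundedGT.finite_ne_bot_of_iSupIndep hind
  refine ⟨hF.toFinset, fun α hα => ?_⟩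
  rw [Set.Finite.mem_toFinset] at hα
  have hbot : tangentPiece I α = ⊥ := by simpa using hα
  rw [eq_bot_iff]
  intro c hc
  have h0 : tangentOfCoeff hI hLI α ⟨c, hc⟩ = 0 := by
    rw [← Submodule.mem_bot k, ← hbot]
    exact tangentOfCoeff_mem_tangentPiece hI hLI _
  have := tangentCoeff_tangentOfCoeff_self hI hLI (⟨c, hc⟩ : homSpace k L α)
  rw [h0, map_zero] at this
  exact (congrArg Subtype.val this).symm

/-- The homomorphism with given coefficients in finitely many degrees. -/
noncomputable def tangentOfCoeffs (hI : IsMonomialIdeal I) (hLI : IsStaircaseOf L I)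
    (B : Finset (Fin n → ℤ)) : (∀ α : B, homSpace k L α.1) →ₗ[k] TangentSpaceAt I :=
  ∑ α : B, (tangentOfCoeff hI hLI α.1).comp (LinearMap.proj α)

lemma tangentOfCoeffs_apply (hI : IsMonomialIdeal I) (hLI : IsStaircaseOf L I)
    (B : Finset (Fin n → ℤ)) (c : ∀ α : B, homSpace k L α.1) :
    tangentOfCoeffs hI hLI B c = ∑ α : B, tangentOfCoeff hI hLI α.1 (c α) := by
  simp [tangentOfCoeffs]

lemma tangentCoeff_tangentOfCoeffs (hI : IsMonomialIdeal I) (hLI : IsStaircaseOf L I)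
    (B : Finset (Fin n → ℤ)) (c : ∀ α : B, homSpace k L α.1) (β : B) :
    tangentCoeff hI hLI β.1 (tangentOfCoeffs hI hLI B c) = c β := by
  rw [tangentOfCoeffs_apply, map_sum, Finset.sum_eq_single β]
  · exact tangentCoeff_tangentOfCoeff_self hI hLI _
  · exact fun α _ h => tangentCoeff_tangentOfCoeff_of_ne hI hLI
      (fun e => h (Subtype.ext e.symm)) _
  · simp

lemma tangentCoeff_tangentOfCoeffs_of_notMem (hI : IsMonomialIdeal I) (hLI : IsStaircaseOf L I)
    (B : Finset (Fin n → ℤ)) (c : ∀ α : B, homSpace k L α.1) {β : Fin n → ℤ} (hβ : β ∉ B) :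
    tangentCoeff hI hLI β (tangentOfCoeffs hI hLI B c) = 0 := by
  rw [tangentOfCoeffs_apply, map_sum]
  refine Finset.sum_eq_zero fun α _ => tangentCoeff_tangentOfCoeff_of_ne hI hLI ?_ _
  rintro rfl
  exact hβ α.2

/-- A homomorphism is determined by its coefficient families, so one supported in finitely many
degrees is the sum of its components. -/
lemma mem_range_tangentOfCoeffs_iff (hI : IsMonomialIdeal I) (hLI : IsStaircaseOf L I)
    (B : Finset (Fin n → ℤ)) (φ : TangentSpaceAt I) :
    φ ∈ LinearMap.range (tangentOfCoeffs hI hLI B) ↔ ∀ β ∉ B, tangentCoeff hI hLI β φ = 0 := by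
  constructor
  · rintro ⟨c, rfl⟩ β hβ
    exact tangentCoeff_tangentOfCoeffs_of_notMem hI hLI B c hβ
  · intro h
    refine ⟨fun α => tangentCoeff hI hLI α.1 φ, tangent_ext hI hLI fun β => ?_⟩
    by_cases hβ : β ∈ B
    · exact tangentCoeff_tangentOfCoeffs hI hLI B _ ⟨β, hβ⟩
    · rw [tangentCoeff_tangentOfCoeffs_of_notMem hI hLI B _ hβ, h β hβ]

lemma finrank_range_tangentOfCoeffs (hI : IsMonomialIdeal I) (hLI : IsStaircaseOf L I)
    (B : Finset (Fin n → ℤ)) : Module.finrank k (LinearMap.range (tangentOfCoeffs hI hLI B))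
      = ∑ α ∈ B, Module.finrank k (homSpace k L α) := by
  rw [LinearMap.finrank_range_of_inj, Module.finrank_pi_fintype,
    Finset.sum_coe_sort B fun α => Module.finrank k (homSpace k L α)]
  intro c c' h
  funext α
  rw [← tangentCoeff_tangentOfCoeffs hI hLI B c, h, tangentCoeff_tangentOfCoeffs]

open Classical in
lemma finrank_tangentSignature (hI : IsMonomialIdeal I) (hLI : IsStaircaseOf L I)
    {B : Finset (Fin n → ℤ)} (hB : ∀ α ∉ B, homSpace k L α = ⊥) (s : Fin n → SignLetter) :
    Module.finrank k (tangentSignature I s)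
      = ∑ α ∈ B.filter (· ∈ signatureDegrees s), Module.finrank k (homSpace k L α) := by
  rw [← finrank_range_tangentOfCoeffs hI hLI]
  suffices h : tangentSignature I s = LinearMap.range
      (tangentOfCoeffs hI hLI (B.filter (· ∈ signatureDegrees s))) by rw [h]
  apply le_antisymm
  · refine iSup₂_le fun α hα φ hφ => ?_
    rw [mem_range_tangentOfCoeffs_iff]
    intro β hβ
    by_cases h : β = α
    · subst h
      have hβB : β ∉ B := fun h => hβ (Finset.mem_filter.mpr ⟨h, hα⟩)
      exact Subtype.ext
        ((Submodule.mem_bot k).mp ((hB β hβB).le (tangentCoeff hI hLI β φ).2))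
    · exact tangentCoeff_of_mem_tangentPiece hI hLI h hφ
  · rintro _ ⟨c, rfl⟩
    rw [tangentOfCoeffs_apply]
    refine Submodule.sum_mem _ fun α _ => ?_
    exact Submodule.mem_iSup_of_mem α.1 (Submodule.mem_iSup_of_mem
      (Finset.mem_filter.mp α.2).2 (tangentOfCoeff_mem_tangentPiece hI hLI _))

lemma finrank_tangentSpace (hI : IsMonomialIdeal I) (hLI : IsStaircaseOf L I)
    {B : Finset (Fin n → ℤ)} (hB : ∀ α ∉ B, homSpace k L α = ⊥) :
    Module.finrank k (TangentSpaceAt I) = ∑ α ∈ B, Module.finrank k (homSpace k L α) := by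
  rw [← finrank_range_tangentOfCoeffs hI hLI, ← finrank_top k (TangentSpaceAt I)]
  suffices h : LinearMap.range (tangentOfCoeffs hI hLI B) = ⊤ by rw [h]
  rw [eq_top_iff]
  intro φ _
  rw [mem_range_tangentOfCoeffs_iff]
  intro β hβ
  exact Subtype.ext ((Submodule.mem_bot k).mp ((hB β hβ).le (tangentCoeff hI hLI β φ).2))

lemma finrank_tangentSignature_eq_sum (hI : IsMonomialIdeal I) (hLI : IsStaircaseOf L I)
    {B : Finset (Fin n → ℤ)} (hB : ∀ α ∉ B, homSpace k L α = ⊥) (s : Fin n → SignLetter) :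
    (Module.finrank k (tangentSignature I s) : ℤ)
      = ∑ α ∈ B, signatureIndicator s α * (Module.finrank k (homSpace k L α) : ℤ) := by
  classical
  rw [finrank_tangentSignature hI hLI hB, Nat.cast_sum, Finset.sum_filter]
  refine Finset.sum_congr rfl fun α _ => ?_
  rw [signatureIndicator_eq_ite]
  split_ifs <;> simp

end Tangent

/-! ### Conclusion: the eight octants and parity. -/

lemma SignLetter.indicator_n (a : ℤ) :
    SignLetter.n.indicator a = 1 - SignLetter.p.indicator a := by
  simp only [SignLetter.indicator]
  split_ifs <;> first | rfl | omega

/-- Expansion of a product of three factors, each the sum of the p- and n-indicators and so equal to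
1. -/
lemma signatureIndicator_sum (α : Fin 3 → ℤ) :
    signatureIndicator ![.p, .p, .p] α + signatureIndicator ![.n, .n, .n] α
      + signatureIndicator ![.p, .p, .n] α + signatureIndicator ![.n, .n, .p] α
      + signatureIndicator ![.p, .n, .p] α + signatureIndicator ![.n, .p, .n] α
      + signatureIndicator ![.n, .p, .p] α + signatureIndicator ![.p, .n, .n] α = 1 := by
  simp only [signatureIndicator, Fin.prod_univ_three, Matrix.cons_val_zero, Matrix.cons_val_one,
    Matrix.cons_val, SignLetter.indicator_n]
  ring

theorem mainTheorem1 {k : Type*} [Field k] (d : ℕ) (I : Ideal (MvPolynomial (Fin 3) k))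
    (hI : IsMonomialIdeal I)
    (hfin : Module.Finite k (MvPolynomial (Fin 3) k ⧸ I))
    (hd : Module.finrank k (MvPolynomial (Fin 3) k ⧸ I) = d) :
    Module.Finite k (TangentSpaceAt I) ∧
    Module.finrank k (tangentSignature I ![.p, .p, .n]) =
      Module.finrank k (tangentSignature I ![.n, .n, .p]) + d ∧
    Module.finrank k (tangentSignature I ![.p, .n, .p]) =
      Module.finrank k (tangentSignature I ![.n, .p, .n]) + d ∧
    Module.finrank k (tangentSignature I ![.n, .p, .p]) =
      Module.finrank k (tangentSignature I ![.p, .n, .n]) + d ∧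
    Module.finrank k (TangentSpaceAt I) ≡ d [MOD 2] := by
  obtain ⟨L, hLI⟩ := hI.exists_isStaircaseOf hfin
  have hL := hLI.isStaircase
  have hcard : L.card = d := by rw [← hd, finrank_quotient hI hLI]
  obtain ⟨F, hF⟩ := exists_finset_homSpace_eq_bot hI hLI hfin
  obtain ⟨B, hFB, hsum⟩ := exists_sum_finrank_homSpace k hL F
  have hB : ∀ α ∉ B, homSpace k L α = ⊥ := fun α hα => hF α fun h => hα (hFB h)
  have hsig := finrank_tangentSignature_eq_sum hI hLI hB
  have hflip : ∀ a b c : SignLetter, (fun i => ((![a, b, c] : Fin 3 → SignLetter) i).flip)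
      = ![a.flip, b.flip, c.flip] := fun a b c => by
    funext i
    fin_cases i <;> rfl
  have key : ∀ (a b c : SignLetter) (i j : Fin 3), ![a, b, c] i = .n → ![a, b, c] j = .p →
      (Module.finrank k (tangentSignature I ![a, b, c]) : ℤ)
        = Module.finrank k (tangentSignature I ![a.flip, b.flip, c.flip])
          - a.sign * b.sign * c.sign * d := by
    intro a b c i j hi hj
    have := hsum ![a, b, c] i j hi hj
    rw [hflip, ← hsig, ← hsig, hcard, Fin.prod_univ_three] at this
    exact this
  have h1 : (Module.finrank k (tangentSignature I ![.p, .p, .n]) : ℤ)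
      = Module.finrank k (tangentSignature I ![.n, .n, .p]) - 1 * 1 * (-1) * d :=
    key .p .p .n 2 0 rfl rfl
  have h2 : (Module.finrank k (tangentSignature I ![.p, .n, .p]) : ℤ)
      = Module.finrank k (tangentSignature I ![.n, .p, .n]) - 1 * (-1) * 1 * d :=
    key .p .n .p 1 0 rfl rfl
  have h3 : (Module.finrank k (tangentSignature I ![.n, .p, .p]) : ℤ)
      = Module.finrank k (tangentSignature I ![.p, .n, .n]) - (-1) * 1 * 1 * d :=
    key .n .p .p 0 1 rfl rfl
  have hppp : Module.finrank k (tangentSignature I ![.p, .p, .p]) = 0 := by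
    classical
    rw [finrank_tangentSignature hI hLI hB]
    refine Finset.sum_eq_zero fun α hα => ?_
    have hs := (Finset.mem_filter.mp hα).2
    rw [hL.homSpace_eq_bot_of_nonneg, finrank_bot]
    intro i
    have := hs i
    fin_cases i <;> exact this
  have hnnn : Module.finrank k (tangentSignature I ![.n, .n, .n]) = 0 := by
    classical
    rw [finrank_tangentSignature hI hLI hB]
    refine Finset.sum_eq_zero fun α hα => ?_
    have hs := (Finset.mem_filter.mp hα).2
    rw [hL.homSpace_eq_bot_of_neg (i := 0) (j := 1) _ (by decide), finrank_bot]
    intro i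
    have := hs i
    fin_cases i <;> exact this
  have htotal : (Module.finrank k (TangentSpaceAt I) : ℤ)
      = Module.finrank k (tangentSignature I ![.p, .p, .p])
      + Module.finrank k (tangentSignature I ![.n, .n, .n])
      + Module.finrank k (tangentSignature I ![.p, .p, .n])
      + Module.finrank k (tangentSignature I ![.n, .n, .p])
      + Module.finrank k (tangentSignature I ![.p, .n, .p])
      + Module.finrank k (tangentSignature I ![.n, .p, .n])
      + Module.finrank k (tangentSignature I ![.n, .p, .p])
      + Module.finrank k (tangentSignature I ![.p, .n, .n]) := by
    simp only [hsig, ← Finset.sum_add_distrib, ← add_mul, signatureIndicator_sum, one_mul]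
    rw [finrank_tangentSpace hI hLI hB, Nat.cast_sum]
  refine ⟨finite_tangentSpace hfin, by omega, by omega, by omega, ?_⟩
  -- The total is twice the sum of the dimensions for nnp, npn and pnn, plus 3d.
  rw [Nat.ModEq]
  omega
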